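/- **Theorem.** The intersection problem for finite monoids, $\textsc{MonIsect}(\mathbf{Mon})$, belongs to $\mathsf{PSPACE}$. Here $\textsc{MonIsect}(\mathbf{Mon})$ is the following decision problem. *Input:* a finite alphabet $A$, finite monoids $M_1,\dots,M_k$, morphisms $h_i\colon A^*\to M_i$ and subsets $P_i\subseteq M_i$ for $1\le i\le k$. *Question:* is $h_1^{-1}(P_1)\cap\dots\cap h_k^{-1}(P_k)\neq\emptyset$? (For $k=0$ the intersection is $A^*$.) An input is encoded, after listing the elements of $A$ and of each $M_i$, by the sequence of natural numbers consisting of $|A|$, followed for each $i=1,\dots,k$ by $|M_i|$, the multiplication table of $M_i$ row by row, the images $h_i(a)$ of the letters $a\in A$, and the characteristic vector of $P_i$; elements of $M_i$ are given by their positions $0,\dots,|M_i|-1$ in the list, and every number is written in binary and followed by a separator symbol. The problem is identified with the language of all encodings (for all listings) of inputs with answer "yes"; in particular a string that encodes no input is not in the language. $\mathsf{PSPACE}$ is the class of languages $L$ over a finite alphabet for which there are a deterministic Turing machine (equivalently, a machine with finitely many states and finitely many stacks) and a polynomial $p$ such that on every input $w$ the machine halts, accepts if and only if $w\in L$, and never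 uses more than $p(|w|)$ cells. -/

import Mathlib

/-! ### Polynomial space -/

/-- The space used by a configuration of a multi-stack machine: the total number of symbols on
its stacks (the input included). -/
def cfgSpace (tm : Turing.FinTM2) (c : tm.Cfg) : ℕ :=
  letI := tm.kFin
  ∑ k, (Turing.TM2.Cfg.stk c k).length

/-- The deterministic machine `tm`, whose input alphabet is identified with `α` by `e` and which
accepts when it halts with an internal state in `acc`, decides the language `L` in space `s`: on
each input `w` it never uses more than `s |w|` cells, it halts, and it accepts iff `w ∈ L`. -/
def DecidesInSpace {α : Type} (tm : Turing.FinTM2) (e : α ≃ tm.Γ tm.k₀) (acc : Set tm.σ)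
    (L : Language α) (s : ℕ → ℕ) : Prop :=
  ∀ w : List α,
    (∀ c : tm.Cfg, StateTransition.Reaches tm.step (Turing.initList tm (w.map e)) c →
      cfgSpace tm c ≤ s w.length) ∧
    ∃ c : tm.Cfg, c ∈ StateTransition.eval tm.step (Turing.initList tm (w.map e)) ∧
      (Turing.TM2.Cfg.var c ∈ acc ↔ w ∈ L)

/-- The class of languages over `α` that are decided by a deterministic machine (with finitely
many states, finitely many stacks and finite stack alphabets) in polynomial space. -/
def PSPACE (α : Type) : Set (Language α) :=
  {L | ∃ (tm : Turing.FinTM2) (e : α ≃ tm.Γ tm.k₀) (acc : Set tm.σ) (p : Polynomial ℕ),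
    (∀ k, Finite (tm.Γ k)) ∧ DecidesInSpace tm e acc L (fun n => p.eval n)}

/-! ### The intersection problem for finite monoids -/

/-- A class of monoids. -/
def MonoidClass : Type 1 := ∀ (M : Type) [Monoid M], Prop

/-- The class of all finite monoids. -/
def Mon : MonoidClass := fun M _ => Finite M

/-- A morphism `hom : A* → M` to a finite monoid whose elements are listed by `enum`, together
with an accepting set `P ⊆ M`. -/
structure Recognizer (A : Type) where
  M : Type
  [monoid : Monoid M]
  size : ℕ
  enum : Fin size ≃ M
  hom : FreeMonoid A →* M
  P : Set M

attribute [instance] Recognizer.monoid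

/-- The language `hom⁻¹(P) ⊆ A*`. -/
def Recognizer.language {A : Type} (R : Recognizer A) : Set (FreeMonoid A) :=
  R.hom ⁻¹' R.P

open Classical in
/-- The description of a recognizer over an alphabet listed by `ltr`: the number `n` of elements,
the `n × n` multiplication table row by row, the images of the letters, and the characteristic
vector of the accepting set. Elements are represented by their positions in the list. -/
noncomputable def Recognizer.code {A : Type} {a : ℕ} (ltr : Fin a ≃ A) (R : Recognizer A) :
    List ℕ :=
  [R.size] ++
  ((List.finRange R.size).flatMap fun x => (List.finRange R.size).map fun y =>
    (R.enum.symm (R.enum x * R.enum y) : ℕ)) ++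
  ((List.finRange a).map fun j => (R.enum.symm (R.hom (FreeMonoid.of (ltr j))) : ℕ)) ++
  ((List.finRange R.size).map fun x => if R.enum x ∈ R.P then 1 else 0)

/-- An input of the intersection problem: a finite alphabet `A` with its letters listed by `ltr`,
and morphisms `h₁, …, hₖ` from `A*` to finite monoids with accepting sets `P₁, …, Pₖ`. -/
structure MonIsectInput where
  A : Type
  numLetters : ℕ
  ltr : Fin numLetters ≃ A
  k : ℕ
  recog : Fin k → Recognizer A

/-- The numerical description of an input: the number of letters, then the `k` recognizers. -/
noncomputable def MonIsectInput.code (I : MonIsectInput) : List ℕ :=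
  I.numLetters :: (List.finRange I.k).flatMap fun i => (I.recog i).code I.ltr

/-- The input as a string: the numbers of its description are written in binary (least
significant bit first), each followed by the separator `cons`. -/
noncomputable def MonIsectInput.encode (I : MonIsectInput) : List Turing.PartrecToTM2.Γ' :=
  Turing.PartrecToTM2.trList I.code

/-- The intersection problem for the class `V`, as the language of all encodings of inputs with
all monoids in `V` for which `h₁⁻¹(P₁) ∩ ⋯ ∩ hₖ⁻¹(Pₖ)` is nonempty. -/
def MonIsect (V : MonoidClass) : Language Turing.PartrecToTM2.Γ' :=
  {w | ∃ I : MonIsectInput, (∀ i, V (I.recog i).M) ∧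
    (⋂ i, (I.recog i).language).Nonempty ∧ I.encode = w}

/-!
The proof shows that a decision procedure which is easy to describe by arithmetic can be run in
polynomial space.

*From functions to machines.* `PolySpace` is an inductively defined class of functions on natural
numbers: it contains the constants, the projections and the successor, and it is closed under
substitution and under primitive recursions whose values have a length polynomial in the lengths of
the arguments. Numbers are held on stacks in bijective binary notation; the number of rounds of a
recursion may be exponential, but the counter that controls them is short. So every function of the
class is computed by a structured stack program in polynomial space (`PolySpace.computes`), and
structured programs are compiled to multi-stack machines (`Run.spaceReaches`). Hence a language is
in `PSPACE` as soon as membership of `w` is a `PolySpacePred` property of a number `stringCode w`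
that the machine computes from `w` (`mem_PSPACE_of_polySpacePred`).

*Closure properties.* `PolySpacePred` is closed under Boolean operations and under quantifiers
whose bounds are functions of the class. By Savitch's bisection it is also closed under
reachability in an exponentially large graph (`PolySpacePred.reachable`): a path of length at most
`2 ^ d` is found by guessing its middle vertex, and the recursion of depth `d` is run with a single
number as its stack.

*The intersection problem.* Let `N = stringCode w`. The list of numbers that `w` encodes has at
most as many entries as `w` has symbols, and each of them is at most `N`, so it is the list of the
digits of a number `L` in base `N + 1`, and `L` has polynomial length. Whether the digits of `L`
are encoded by `w`, and whether they describe monoids, morphisms and accepting sets, is a bounded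
formula. A tuple of elements of `M₁, …, Mₖ` is again a sequence of digits in base `N + 1`, and the
intersection is nonempty iff a tuple of accepting elements is reachable from the tuple of neutral
elements by multiplications with letters. `AcceptsCode N` is the conjunction of these conditions.
-/

namespace SpaceBounded

open Turing Turing.PartrecToTM2 Function

/-! ### A structured language for stack machines -/

/-- The contents of the stacks of a program. Programs name their stacks by natural numbers, and
all stacks carry symbols from `Γ'`. -/
abbrev Store := ℕ → List Γ'

/-- Structured programs acting on stacks. The tests of `ite` and `loop` inspect the top symbol of a
stack (`none` if it is empty) and leave the stack unchanged. -/
inductive Cmd : Type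
  | skip : Cmd
  | push (k : ℕ) (x : Γ') : Cmd
  | pop (k : ℕ) : Cmd
  | seq (c d : Cmd) : Cmd
  | ite (k : ℕ) (p : Option Γ' → Bool) (c d : Cmd) : Cmd
  | loop (k : ℕ) (p : Option Γ' → Bool) (c : Cmd) : Cmd

/-- Every stack of `s` has at most `B` symbols. -/
def Fits (B : ℕ) (s : Store) : Prop := ∀ k, (s k).length ≤ B

/-- `Run B c s t`: the program `c`, started in the store `s`, terminates in the store `t`, and in
all stores on the way every stack has at most `B` symbols. -/
inductive Run (B : ℕ) : Cmd → Store → Store → Prop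
  | skip {s : Store} : Fits B s → Run B .skip s s
  | push {s : Store} (k : ℕ) (x : Γ') : Fits B s → Fits B (update s k (x :: s k)) →
      Run B (.push k x) s (update s k (x :: s k))
  | pop {s : Store} (k : ℕ) : Fits B s → Run B (.pop k) s (update s k (s k).tail)
  | seq {c d : Cmd} {s t u : Store} : Run B c s t → Run B d t u → Run B (.seq c d) s u
  | ite_true {k : ℕ} {p : Option Γ' → Bool} {c d : Cmd} {s t : Store} :
      p (s k).head? = true → Run B c s t → Run B (.ite k p c d) s t
  | ite_false {k : ℕ} {p : Option Γ' → Bool} {c d : Cmd} {s t : Store} :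
      p (s k).head? = false → Run B d s t → Run B (.ite k p c d) s t
  | loop_true {k : ℕ} {p : Option Γ' → Bool} {c : Cmd} {s t u : Store} :
      p (s k).head? = true → Run B c s t → Run B (.loop k p c) t u → Run B (.loop k p c) s u
  | loop_false {k : ℕ} {p : Option Γ' → Bool} {c : Cmd} {s : Store} : Fits B s →
      p (s k).head? = false → Run B (.loop k p c) s s

theorem Fits.mono {B B' : ℕ} {s : Store} (h : Fits B s) (hB : B ≤ B') : Fits B' s :=
  fun k => (h k).trans hB

theorem Fits.update {B : ℕ} {s : Store} (h : Fits B s) (k : ℕ) {l : List Γ'}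
    (hl : l.length ≤ B) : Fits B (update s k l) := by
  intro j
  by_cases hj : j = k
  · subst hj; simpa using hl
  · simpa [hj] using h j

theorem Run.fits_left {B : ℕ} {c : Cmd} {s t : Store} (h : Run B c s t) : Fits B s := by
  induction h <;> assumption

theorem Run.fits_right {B : ℕ} {c : Cmd} {s t : Store} (h : Run B c s t) : Fits B t := by
  induction h with
  | pop k hs => exact hs.update k ((List.length_tail ..).trans_le ((Nat.sub_le ..).trans (hs k)))
  | _ => assumption

theorem Run.mono {B B' : ℕ} (hB : B ≤ B') {c : Cmd} {s t : Store} (h : Run B c s t) :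
    Run B' c s t := by
  induction h with
  | skip hs => exact .skip (hs.mono hB)
  | push k x hs ht => exact .push k x (hs.mono hB) (ht.mono hB)
  | pop k hs => exact .pop k (hs.mono hB)
  | seq _ _ h₁ h₂ => exact .seq h₁ h₂
  | ite_true hp _ ih => exact .ite_true hp ih
  | ite_false hp _ ih => exact .ite_false hp ih
  | loop_true hp _ _ h₁ h₂ => exact .loop_true hp h₁ h₂
  | loop_false hs hp => exact .loop_false (hs.mono hB) hp

/-- A loop whose body leads through the stores `s 0, …, s n`, where only the last one fails the
test. -/
theorem Run.loop_of_seq {B k n : ℕ} {p : Option Γ' → Bool} {c : Cmd} (s : ℕ → Store)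
    (hfit : Fits B (s n)) (hlast : p (s n k).head? = false)
    (htest : ∀ j < n, p (s j k).head? = true) (hbody : ∀ j < n, Run B c (s j) (s (j + 1))) :
    Run B (.loop k p c) (s 0) (s n) := by
  induction n generalizing s with
  | zero => exact .loop_false hfit hlast
  | succ n ih =>
    refine .loop_true (htest 0 n.succ_pos) (hbody 0 n.succ_pos) ?_
    exact ih (fun j => s (j + 1)) hfit hlast (fun j hj => htest _ (Nat.succ_lt_succ hj))
      (fun j hj => hbody _ (Nat.succ_lt_succ hj))

/-! ### Compilation of structured programs to multi-stack machines -/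

namespace Cmd

/-- The program points of a program. -/
def Label : Cmd → Type
  | skip => Unit
  | push _ _ => Unit
  | pop _ => Unit
  | seq c d => c.Label ⊕ d.Label
  | ite _ _ c d => Option (c.Label ⊕ d.Label)
  | loop _ _ c => Option c.Label

/-- A program has finitely many program points. -/
@[reducible]
def labelFintype : (c : Cmd) → Fintype c.Label
  | skip => inferInstanceAs (Fintype Unit)
  | push _ _ => inferInstanceAs (Fintype Unit)
  | pop _ => inferInstanceAs (Fintype Unit)
  | seq c d =>
    letI := c.labelFintype; letI := d.labelFintype; inferInstanceAs (Fintype (c.Label ⊕ d.Label))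
  | ite _ _ c d =>
    letI := c.labelFintype; letI := d.labelFintype
    inferInstanceAs (Fintype (Option (c.Label ⊕ d.Label)))
  | loop _ _ c => letI := c.labelFintype; inferInstanceAs (Fintype (Option c.Label))

/-- The program point where execution starts. -/
def entry : (c : Cmd) → c.Label
  | skip => ()
  | push _ _ => ()
  | pop _ => ()
  | seq c _ => .inl c.entry
  | ite _ _ _ _ => none
  | loop _ _ _ => none

/-- An upper bound for the names of the stacks that occur in a program. -/
def bound : Cmd → ℕ
  | skip => 0
  | push k _ => k + 1
  | pop k => k + 1
  | seq c d => max c.bound d.bound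
  | ite k _ c d => max (k + 1) (max c.bound d.bound)
  | loop k _ c => max (k + 1) c.bound

/-- The stack named `k`, in a machine with `R + 1` stacks. -/
def reg (R k : ℕ) : Fin (R + 1) := ⟨min k R, by omega⟩

/-- The machine statement at each program point, for a machine with `R + 1` stacks. The labels of
`c` are embedded into those of the machine by `emb`, and control passes to `ex` at the end. The
internal state of the machine holds the symbol seen by the last test. -/
def code {R : ℕ} {Λ : Type} : (c : Cmd) → (c.Label → Λ) → Λ → c.Label →
    TM2.Stmt (fun _ : Fin (R + 1) => Γ') Λ (Option Γ')
  | skip, _, ex, _ => .goto fun _ => ex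
  | push k x, _, ex, _ => .push (reg R k) (fun _ => x) (.goto fun _ => ex)
  | pop k, _, ex, _ => .pop (reg R k) (fun v _ => v) (.goto fun _ => ex)
  | seq c d, emb, _, .inl l => c.code (fun l => emb (.inl l)) (emb (.inr d.entry)) l
  | seq _ d, emb, ex, .inr l => d.code (fun l => emb (.inr l)) ex l
  | ite k p c d, emb, _, none => .peek (reg R k) (fun _ x => x) (.branch p
      (.goto fun _ => emb (some (.inl c.entry))) (.goto fun _ => emb (some (.inr d.entry))))
  | ite _ _ c _, emb, ex, some (.inl l) => c.code (fun l => emb (some (.inl l))) ex l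
  | ite _ _ _ d, emb, ex, some (.inr l) => d.code (fun l => emb (some (.inr l))) ex l
  | loop k p c, emb, ex, none => .peek (reg R k) (fun _ x => x) (.branch p
      (.goto fun _ => emb (some c.entry)) (.goto fun _ => ex))
  | loop _ _ c, emb, _, some l => c.code (fun l => emb (some l)) (emb none) l

end Cmd

/-- The stacks of a machine with `R + 1` stacks that holds the store `s`. -/
def Store.restrict (R : ℕ) (s : Store) : Fin (R + 1) → List Γ' := fun k => s k

theorem Store.restrict_update {R k : ℕ} (hk : k < R + 1) (s : Store) (l : List Γ') :
    update (s.restrict R) (Cmd.reg R k) l = Store.restrict R (update s k l) := by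
  have hv : (Cmd.reg R k : ℕ) = k := by simp only [Cmd.reg]; omega
  funext j
  by_cases h : (j : ℕ) = k
  · have hj : j = Cmd.reg R k := Fin.ext (h.trans hv.symm)
    subst hj
    simp [Store.restrict, hv]
  · have hj : j ≠ Cmd.reg R k := fun e => h (by rw [e, hv])
    simp [Store.restrict, h, hj]

theorem Store.restrict_reg {R k : ℕ} (hk : k < R + 1) (s : Store) :
    s.restrict R (Cmd.reg R k) = s k := by
  have hv : (Cmd.reg R k : ℕ) = k := by simp only [Cmd.reg]; omega
  simp [Store.restrict, hv]

/-- `SpaceReaches m B a b`: the machine `m` gets from the configuration `a` to `b` through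
configurations (the last one not counted) all of whose stacks have at most `B` symbols. -/
def SpaceReaches {R : ℕ} {Λ : Type} (m : Λ → TM2.Stmt (fun _ : Fin (R + 1) => Γ') Λ (Option Γ'))
    (B : ℕ) : TM2.Cfg (fun _ : Fin (R + 1) => Γ') Λ (Option Γ') →
      TM2.Cfg (fun _ : Fin (R + 1) => Γ') Λ (Option Γ') → Prop :=
  Relation.ReflTransGen fun a b => (∀ k, (a.stk k).length ≤ B) ∧ b ∈ TM2.step m a

/-- Compiled programs simulate the runs of their sources, in the same space. -/
theorem Run.spaceReaches {R : ℕ} {Λ : Type}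
    {m : Λ → TM2.Stmt (fun _ : Fin (R + 1) => Γ') Λ (Option Γ')} {B : ℕ} {c : Cmd} {s t : Store}
    (h : Run B c s t) (hR : c.bound ≤ R + 1) (emb : c.Label → Λ) (ex : Λ)
    (hm : ∀ l, m (emb l) = c.code emb ex l) (v : Option Γ') :
    ∃ v', SpaceReaches m B ⟨some (emb c.entry), v, s.restrict R⟩ ⟨some ex, v', t.restrict R⟩ := by
  have fit : ∀ {s : Store}, Fits B s → ∀ k, (s.restrict R k).length ≤ B := fun hs k => hs k
  induction h generalizing ex v with
  | skip hs => exact ⟨v, .single ⟨fit hs, by simp [hm, Cmd.code]⟩⟩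
  | push k x hs _ =>
    refine ⟨v, .single ⟨fit hs, ?_⟩⟩
    have hk : k < R + 1 := hR
    have h0 := hm ()
    simp only [Cmd.code] at h0
    simp [Cmd.entry, h0, Store.restrict_update hk, Store.restrict_reg hk]
  | pop k hs =>
    refine ⟨v, .single ⟨fit hs, ?_⟩⟩
    have hk : k < R + 1 := hR
    have h0 := hm ()
    simp only [Cmd.code] at h0
    simp [Cmd.entry, h0, Store.restrict_update hk, Store.restrict_reg hk]
  | @seq c d _ _ _ _ _ ih₁ ih₂ =>
    simp only [Cmd.bound, max_le_iff] at hR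
    obtain ⟨v₁, h₁⟩ := ih₁ hR.1 (fun l => emb (.inl l)) (emb (.inr d.entry)) (fun l => hm _) v
    obtain ⟨v₂, h₂⟩ := ih₂ hR.2 (fun l => emb (.inr l)) ex (fun l => hm _) v₁
    exact ⟨v₂, h₁.trans h₂⟩
  | @ite_true k p c d s _ hp hr ih =>
    simp only [Cmd.bound, max_le_iff] at hR
    obtain ⟨v₁, h₁⟩ := ih hR.2.1 (fun l => emb (some (.inl l))) ex (fun l => hm _) (s k).head?
    refine ⟨v₁, .head ⟨fit hr.fits_left, ?_⟩ h₁⟩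
    have h0 := hm none
    simp only [Cmd.code] at h0
    simp [h0, Cmd.entry, Store.restrict_reg hR.1, hp]
  | @ite_false k p c d s _ hp hr ih =>
    simp only [Cmd.bound, max_le_iff] at hR
    obtain ⟨v₁, h₁⟩ := ih hR.2.2 (fun l => emb (some (.inr l))) ex (fun l => hm _) (s k).head?
    refine ⟨v₁, .head ⟨fit hr.fits_left, ?_⟩ h₁⟩
    have h0 := hm none
    simp only [Cmd.code] at h0
    simp [h0, Cmd.entry, Store.restrict_reg hR.1, hp]
  | @loop_true k p c s _ _ hp hr _ ih₁ ih₂ =>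
    have hR' := hR
    simp only [Cmd.bound, max_le_iff] at hR'
    obtain ⟨v₁, h₁⟩ := ih₁ hR'.2 (fun l => emb (some l)) (emb none) (fun l => hm _) (s k).head?
    obtain ⟨v₂, h₂⟩ := ih₂ hR emb ex hm v₁
    refine ⟨v₂, .head ⟨fit hr.fits_left, ?_⟩ (h₁.trans h₂)⟩
    have h0 := hm none
    simp only [Cmd.code] at h0
    simp [h0, Cmd.entry, Store.restrict_reg hR'.1, hp]
  | @loop_false k p c s hs hp =>
    simp only [Cmd.bound, max_le_iff] at hR
    refine ⟨(s k).head?, .single ⟨fit hs, ?_⟩⟩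
    have h0 := hm none
    simp only [Cmd.code] at h0
    simp [h0, Cmd.entry, Store.restrict_reg hR.1, hp]

/-- The machine that runs `c`, with its input on the stack `0`, and then inspects the stack
`out`. -/
def machine (c : Cmd) (out R : ℕ) : FinTM2 where
  K := Fin (R + 1)
  k₀ := 0
  k₁ := 0
  Γ := fun _ => Γ'
  Λ := Option c.Label
  main := some c.entry
  ΛFin := letI := c.labelFintype; inferInstance
  σ := Option Γ'
  initialState := none
  Γk₀Fin := inferInstanceAs (Fintype Γ')
  m := fun
    | none => .peek (Cmd.reg R out) (fun _ x => x) .halt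
    | some l => c.code some none l

theorem initList_stk_input (tm : FinTM2) (w : List (tm.Γ tm.k₀)) :
    (initList tm w).stk tm.k₀ = w := by
  simp [initList]

theorem initList_stk_of_ne (tm : FinTM2) (w : List (tm.Γ tm.k₀)) {k : tm.K} (hk : k ≠ tm.k₀) :
    (initList tm w).stk k = [] := by
  simp [initList, hk]

theorem initList_machine (c : Cmd) (out R : ℕ) (w : List Γ') :
    initList (machine c out R) w =
      ⟨some (some c.entry), none, Store.restrict R (update (fun _ => []) 0 w)⟩ := by
  have hstk : (initList (machine c out R) w).stk =
      Store.restrict R (update (fun _ => []) 0 w) := by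
    funext (k : Fin (R + 1))
    by_cases hk : k = 0
    · subst hk
      exact initList_stk_input (machine c out R) w
    · have hk' : (k : ℕ) ≠ 0 := fun e => hk (Fin.ext e)
      refine (initList_stk_of_ne (machine c out R) w hk).trans ?_
      exact (update_of_ne hk' w fun _ => []).symm
  rw [← hstk]
  rfl

/-- By determinism, every configuration that a machine reaches lies on the path that leads to its
final configuration. -/
theorem forall_of_reaches_of_path {σ : Type} {f : σ → Option σ} {P : σ → Prop} {a b c : σ}
    (h : Relation.ReflTransGen (fun x y => P x ∧ y ∈ f x) a b) (hb : f b = none) (hP : P b)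
    (hc : StateTransition.Reaches f a c) : P c := by
  induction h using Relation.ReflTransGen.head_induction_on with
  | refl =>
    rcases Relation.ReflTransGen.cases_head hc with rfl | ⟨b', hb', _⟩
    · exact hP
    · simp [hb] at hb'
  | head hab _ ih =>
    rcases Relation.ReflTransGen.cases_head hc with rfl | ⟨b', hb', hr⟩
    · exact hab.1
    · exact ih (Option.mem_unique hb' hab.2 ▸ hr)

/-- A language is in `PSPACE` if a structured program decides it in polynomial space, where
acceptance means that the stack `out` is nonempty at the end. -/
theorem mem_PSPACE_of_run {L : Language Γ'} (c : Cmd) (out : ℕ) (p : Polynomial ℕ)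
    (h : ∀ w : List Γ', ∃ s : Store,
      Run (p.eval w.length) c (update (fun _ => []) 0 w) s ∧ (s out ≠ [] ↔ w ∈ L)) :
    L ∈ PSPACE Γ' := by
  obtain ⟨R, hR, ho⟩ : ∃ R, c.bound ≤ R + 1 ∧ out < R + 1 :=
    ⟨max c.bound out, by omega, by omega⟩
  refine ⟨machine c out R, Equiv.refl _, {v : Option Γ' | v ≠ none},
    Polynomial.C (R + 1) * p, fun _ => inferInstanceAs (Finite Γ'), fun w => ?_⟩
  obtain ⟨s, hrun, hs⟩ := h w
  let tm := machine c out R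
  have hinit : initList tm (w.map (Equiv.refl Γ')) =
      ⟨some (some c.entry), none, Store.restrict R (update (fun _ => []) 0 w)⟩ := by
    rw [← initList_machine]
    exact congrArg _ (List.map_id w)
  obtain ⟨v, hv⟩ := hrun.spaceReaches (m := tm.m) hR some none (fun _ => rfl) none
  have hlast : (⟨none, (s out).head?, s.restrict R⟩ : tm.Cfg) ∈
      tm.step ⟨some none, v, s.restrict R⟩ := by
    change some _ = some _
    rw [← Store.restrict_reg ho s]
    rfl
  have hfin : SpaceReaches tm.m (p.eval w.length)
      ⟨some (some c.entry), none, Store.restrict R (update (fun _ => []) 0 w)⟩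
      ⟨none, (s out).head?, s.restrict R⟩ :=
    hv.tail ⟨fun k => hrun.fits_right k, hlast⟩
  have hspace : ∀ a : tm.Cfg, (∀ k : Fin (R + 1), (a.stk k).length ≤ p.eval w.length) →
      cfgSpace tm a ≤ (Polynomial.C (R + 1) * p).eval w.length := by
    intro a ha
    rw [Polynomial.eval_mul, Polynomial.eval_C]
    calc cfgSpace tm a = ∑ k : Fin (R + 1), (a.stk k).length := rfl
      _ ≤ ∑ _k : Fin (R + 1), p.eval w.length := Finset.sum_le_sum fun k _ => ha k
      _ = _ := by simp
  change (∀ a : tm.Cfg, StateTransition.Reaches tm.step (initList tm (w.map (Equiv.refl Γ'))) a →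
    cfgSpace tm a ≤ _) ∧ ∃ a : tm.Cfg, a ∈ StateTransition.eval tm.step
      (initList tm (w.map (Equiv.refl Γ'))) ∧ (_ ↔ _)
  rw [hinit]
  refine ⟨fun a ha => ?_, ⟨none, (s out).head?, s.restrict R⟩, ?_, ?_⟩
  · refine hspace a (forall_of_reaches_of_path (σ := tm.Cfg)
      (P := fun a => ∀ k : Fin (R + 1), (a.stk k).length ≤ p.eval w.length) hfin rfl ?_ ha)
    exact fun k => hrun.fits_right k
  · exact StateTransition.mem_eval.2 ⟨Relation.ReflTransGen.mono (fun _ _ h => h.2) _ _ hfin, rfl⟩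
  · rw [← hs]
    change (s out).head? ≠ none ↔ _
    cases s out <;> simp

/-! ### Bijective binary numerals -/

/-- The successor of a numeral in bijective base two, least significant digit first: `bit0` stands
for the digit one and `bit1` for the digit two. -/
def incNumeral : List Γ' → List Γ'
  | [] => [.bit0]
  | .bit0 :: l => .bit1 :: l
  | _ :: l => .bit0 :: incNumeral l

/-- The numeral of `n` in bijective base two. Zero is the empty list, so that a stack holds zero
iff it is empty. -/
def num (n : ℕ) : List Γ' := incNumeral^[n] []

theorem num_zero : num 0 = [] := rfl

theorem num_succ (n : ℕ) : num (n + 1) = incNumeral (num n) := iterate_succ_apply' ..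

/-- A list of digits begins with a block of twos, through which the carry of an increment runs. -/
theorem exists_eq_replicate_append {l : List Γ'} (h : ∀ x ∈ l, x = .bit0 ∨ x = .bit1) :
    ∃ m, l = List.replicate m .bit1 ∧ incNumeral l = List.replicate (m + 1) .bit0 ∨
      ∃ l', l = List.replicate m .bit1 ++ .bit0 :: l' ∧
        incNumeral l = List.replicate m .bit0 ++ .bit1 :: l' := by
  induction l with
  | nil => exact ⟨0, .inl ⟨rfl, rfl⟩⟩
  | cons x l ih =>
    rcases h x (by simp) with rfl | rfl
    · exact ⟨0, .inr ⟨l, rfl, rfl⟩⟩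
    · obtain ⟨m, ⟨h₁, h₂⟩ | ⟨l', h₁, h₂⟩⟩ := ih fun y hy => h y (by simp [hy])
      · exact ⟨m + 1, .inl ⟨by simp [h₁, List.replicate_succ],
          by simp [incNumeral, h₂, List.replicate_succ]⟩⟩
      · exact ⟨m + 1, .inr ⟨l', by simp [h₁, List.replicate_succ],
          by simp [incNumeral, h₂, List.replicate_succ]⟩⟩

theorem incNumeral_digits {l : List Γ'} (h : ∀ x ∈ l, x = .bit0 ∨ x = .bit1) :
    ∀ x ∈ incNumeral l, x = .bit0 ∨ x = .bit1 := by
  induction l with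
  | nil => simp [incNumeral]
  | cons x l ih =>
    have hl : ∀ y ∈ l, y = .bit0 ∨ y = .bit1 := fun y hy => h y (by simp [hy])
    rcases h x (by simp) with rfl | rfl
    · intro y hy
      rcases List.mem_cons.1 hy with rfl | hy
      exacts [.inr rfl, hl y hy]
    · intro y hy
      rcases List.mem_cons.1 hy with rfl | hy
      exacts [.inl rfl, ih hl y hy]

theorem num_digits (n : ℕ) : ∀ x ∈ num n, x = Γ'.bit0 ∨ x = .bit1 := by
  induction n with
  | zero => simp [num_zero]
  | succ n ih => rw [num_succ]; exact incNumeral_digits ih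

/-- The value of a numeral in bijective base two. -/
def numeralValue : List Γ' → ℕ
  | [] => 0
  | .bit0 :: l => 2 * numeralValue l + 1
  | _ :: l => 2 * numeralValue l + 2

theorem numeralValue_incNumeral {l : List Γ'} (h : ∀ x ∈ l, x = .bit0 ∨ x = .bit1) :
    numeralValue (incNumeral l) = numeralValue l + 1 := by
  induction l with
  | nil => rfl
  | cons x l ih =>
    have hl : ∀ y ∈ l, y = .bit0 ∨ y = .bit1 := fun y hy => h y (by simp [hy])
    rcases h x (by simp) with rfl | rfl
    · rfl
    · simp only [incNumeral, numeralValue, ih hl]; ring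

theorem numeralValue_num (n : ℕ) : numeralValue (num n) = n := by
  induction n with
  | zero => rfl
  | succ n ih => rw [num_succ, numeralValue_incNumeral (num_digits n), ih]

theorem pow_length_le_numeralValue (l : List Γ') :
    2 ^ l.length ≤ numeralValue l + 1 ∧ numeralValue l + 2 ≤ 2 ^ (l.length + 1) := by
  induction l with
  | nil => simp [numeralValue]
  | cons x l ih =>
    have : numeralValue (x :: l) = 2 * numeralValue l + 1 ∨
        numeralValue (x :: l) = 2 * numeralValue l + 2 := by cases x <;> simp [numeralValue]
    simp only [List.length_cons, pow_succ] at ih ⊢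
    omega

theorem length_num (n : ℕ) : (num n).length = Nat.log 2 (n + 1) := by
  have h := pow_length_le_numeralValue (num n)
  rw [numeralValue_num] at h
  exact (Nat.log_eq_of_pow_le_of_lt_pow h.1 (by omega)).symm

theorem length_num_mono {m n : ℕ} (h : m ≤ n) : (num m).length ≤ (num n).length := by
  rw [length_num, length_num]
  exact Nat.log_mono_right (by omega)

/-! ### Basic programs on numerals -/

theorem Run.congr {B : ℕ} {c : Cmd} {s t t' : Store} (h : Run B c s t) (e : t = t') :
    Run B c s t' :=
  e ▸ h

namespace Cmd

/-- Empty the stack `k`. -/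
def clear (k : ℕ) : Cmd := loop k Option.isSome (pop k)

/-- Replace the symbols `x` on top of the stack `k` by as many `y` on the stack `t`. -/
def shift (k t : ℕ) (x y : Γ') : Cmd := loop k (fun z => z == some x) (seq (pop k) (push t y))

/-- Increment the numeral on the stack `k`, with the empty stack `t` as auxiliary. -/
def inc (k t : ℕ) : Cmd :=
  seq (shift k t .bit1 .bit0) <|
  seq (ite k (fun z => z == some .bit0) (seq (pop k) (push k .bit1)) (push k .bit0)) <|
  shift t k .bit0 .bit0

/-- Decrement the numeral on the stack `k`, with the empty stack `t` as auxiliary. -/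
def dec (k t : ℕ) : Cmd :=
  seq (shift k t .bit0 .bit1) <|
  seq (ite k (fun z => z == some .bit1) (seq (pop k) (push k .bit0)) (pop t)) <|
  shift t k .bit1 .bit1

/-- Move the digits on the stack `k` to both stacks `i` and `j`, in reverse order. -/
def drain (k i j : ℕ) : Cmd :=
  loop k Option.isSome <| ite k (fun z => z == some .bit0)
    (seq (pop k) (seq (push i .bit0) (push j .bit0)))
    (seq (pop k) (seq (push i .bit1) (push j .bit1)))

/-- Copy the numeral on the stack `k` to the stack `o`, with the empty stacks `t` and `t'` as
auxiliaries. -/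
def copy (k o t t' : ℕ) : Cmd :=
  seq (clear o) <| seq (drain k t t') <| seq (clear t') (drain t k o)

end Cmd

theorem run_clear {B : ℕ} {s : Store} (h : Fits B s) (k : ℕ) :
    Run B (.clear k) s (update s k []) := by
  generalize hl : s k = l
  induction l generalizing s with
  | nil => rw [← hl, update_eq_self]; exact .loop_false h (by simp [hl])
  | cons x l ih =>
    have h1 := Run.pop k h
    refine .loop_true (by simp [hl]) h1 ?_
    exact Run.congr (ih h1.fits_right (by simp [hl])) (by simp)

theorem run_shift {B k t m : ℕ} {x y : Γ'} {l : List Γ'} {s : Store} (hkt : k ≠ t)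
    (h : Fits B s) (hk : s k = List.replicate m x ++ l) (hl : l.head? ≠ some x)
    (ht : m + (s t).length ≤ B) :
    Run B (.shift k t x y) s (update (update s k l) t (List.replicate m y ++ s t)) := by
  induction m generalizing s with
  | zero =>
    have : update (update s k l) t (List.replicate 0 y ++ s t) = s := by
      funext j; grind [Function.update_apply]
    rw [this]
    exact .loop_false h (by simpa [hk] using hl)
  | succ m ih =>
    have h1 := Run.pop k h
    have h2 := Run.push (s := update s k (s k).tail) t y h1.fits_right
      (h1.fits_right.update t (by simp [hkt.symm]; omega))
    refine .loop_true (by simp [hk, List.replicate_succ]) (.seq h1 h2) ?_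
    have h3 := ih h2.fits_right (by simp [hkt, hk, List.replicate_succ])
      (by simp [hkt.symm]; omega)
    refine Run.congr (h3) ?_
    funext j
    have : List.replicate (m + 1) y = List.replicate m y ++ [y] := List.replicate_succ'
    grind [Function.update_apply]

theorem run_inc {S k t n : ℕ} {s : Store} (hkt : k ≠ t) (h : Fits S s) (hk : s k = num n)
    (ht : s t = []) : Run (S + 1) (.inc k t) s (update s k (num (n + 1))) := by
  have hS : Fits (S + 1) s := h.mono S.le_succ
  have hlen : (s k).length ≤ S := h k
  obtain ⟨m, ⟨h₁, h₂⟩ | ⟨l, h₁, h₂⟩⟩ := exists_eq_replicate_append (num_digits n)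
  · have hm : m ≤ S := by simpa [hk, h₁] using hlen
    have r1 := run_shift (m := m) (x := .bit1) (y := .bit0) hkt hS (l := [])
      (by rw [hk, h₁]; simp) (by simp) (by simp [ht]; omega)
    have r2 := Run.push k .bit0 r1.fits_right (r1.fits_right.update k (by simp [hkt]))
    have r3 := run_shift (x := .bit0) (y := .bit0) (l := []) (m := m) hkt.symm r2.fits_right
      (by simp [hkt.symm, ht]) (by simp) (by simp [hkt]; omega)
    refine Run.congr (Run.seq r1 (.seq (.ite_false (by simp [hkt]) r2) r3)) ?_
    funext j
    have : List.replicate (m + 1) Γ'.bit0 = List.replicate m Γ'.bit0 ++ [Γ'.bit0] :=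
      List.replicate_succ'
    rw [num_succ, h₂]
    grind [Function.update_apply]
  · have hm : m + l.length + 1 ≤ S := by simpa [hk, h₁, add_assoc] using hlen
    have r1 := run_shift (y := .bit0) hkt hS (l := .bit0 :: l) (by rw [hk, h₁]) (by simp)
      (by simp [ht]; omega)
    have r2 := Run.pop k r1.fits_right
    have r2' := Run.push k .bit1 r2.fits_right
      (r2.fits_right.update k (by simp [hkt]; omega))
    have r3 := run_shift (x := .bit0) (y := .bit0) (l := []) (m := m) hkt.symm r2'.fits_right
      (by simp [hkt.symm, ht]) (by simp) (by simp [hkt]; omega)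
    refine Run.congr (Run.seq r1 (.seq (.ite_true (by simp [hkt]) (.seq r2 r2')) r3)) ?_
    funext j
    rw [num_succ, h₂]
    grind [Function.update_apply]

theorem run_dec {S k t n : ℕ} {s : Store} (hkt : k ≠ t) (h : Fits S s) (hk : s k = num (n + 1))
    (ht : s t = []) : Run (S + 1) (.dec k t) s (update s k (num n)) := by
  have hS : Fits (S + 1) s := h.mono S.le_succ
  have hlen : (s k).length ≤ S := h k
  rw [num_succ] at hk
  obtain ⟨m, ⟨h₁, h₂⟩ | ⟨l, h₁, h₂⟩⟩ := exists_eq_replicate_append (num_digits n)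
  · have hm : m + 1 ≤ S := by simpa [hk, h₂] using hlen
    have r1 := run_shift (m := m + 1) (x := .bit0) (y := .bit1) hkt hS (l := [])
      (by rw [hk, h₂]; simp) (by simp) (by simp [ht]; omega)
    have r2 := Run.pop t r1.fits_right
    have r3 := run_shift (x := .bit1) (y := .bit1) (l := []) (m := m) hkt.symm r2.fits_right
      (by simp [ht]) (by simp) (by simp [hkt]; omega)
    refine Run.congr (Run.seq r1 (.seq (.ite_false (by simp [hkt]) r2) r3)) ?_
    funext j
    rw [h₁]
    grind [Function.update_apply]
  · have hm : m + l.length + 1 ≤ S := by simpa [hk, h₂, add_assoc] using hlen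
    have r1 := run_shift (y := .bit1) hkt hS (l := .bit1 :: l) (by rw [hk, h₂]) (by simp)
      (by simp [ht]; omega)
    have r2 := Run.pop k r1.fits_right
    have r2' := Run.push k .bit0 r2.fits_right
      (r2.fits_right.update k (by simp [hkt]; omega))
    have r3 := run_shift (x := .bit1) (y := .bit1) (l := []) (m := m) hkt.symm r2'.fits_right
      (by simp [hkt.symm, ht]) (by simp) (by simp [hkt]; omega)
    refine Run.congr (Run.seq r1 (.seq (.ite_true (by simp [hkt]) (.seq r2 r2')) r3)) ?_
    funext j
    rw [h₁]
    grind [Function.update_apply]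

theorem run_drain {B k i j : ℕ} {l : List Γ'} {s : Store} (hki : k ≠ i) (hkj : k ≠ j)
    (hij : i ≠ j) (h : Fits B s) (hk : s k = l) (hl : ∀ x ∈ l, x = .bit0 ∨ x = .bit1)
    (hi : l.length + (s i).length ≤ B) (hj : l.length + (s j).length ≤ B) :
    Run B (.drain k i j) s
      (update (update (update s k []) i (l.reverse ++ s i)) j (l.reverse ++ s j)) := by
  induction l generalizing s with
  | nil =>
    have : update (update (update s k []) i ([].reverse ++ s i)) j ([].reverse ++ s j) = s := by
      funext j; grind [Function.update_apply]
    rw [this]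
    exact .loop_false h (by simp [hk])
  | cons x l ih =>
    simp only [List.length_cons] at hi hj
    have r1 := Run.pop k h
    have r2 := Run.push (s := update s k (s k).tail) i x r1.fits_right
      (r1.fits_right.update i (by simp [hki.symm]; omega))
    have r3 := Run.push j x r2.fits_right
      (r2.fits_right.update j (by simp [hkj.symm, hij.symm]; omega))
    have r4 := ih r3.fits_right (by simp [hki, hkj, hk]) (fun y hy => hl y (by simp [hy]))
      (by simp [hki.symm, hij]; omega) (by simp [hkj.symm, hij.symm]; omega)
    have hbody : Run B (.ite k (fun z => z == some .bit0)
        (.seq (.pop k) (.seq (.push i .bit0) (.push j .bit0)))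
        (.seq (.pop k) (.seq (.push i .bit1) (.push j .bit1)))) s
        (update (update (update s k (s k).tail) i (x :: update s k (s k).tail i)) j
          (x :: update (update s k (s k).tail) i (x :: update s k (s k).tail i) j)) := by
      rcases hl x (by simp) with rfl | rfl
      · exact .ite_true (by simp [hk]) (.seq r1 (.seq r2 r3))
      · exact .ite_false (by simp [hk]) (.seq r1 (.seq r2 r3))
    refine Run.congr (Run.loop_true (by simp [hk]) hbody r4) ?_
    funext q
    grind [Function.update_apply]

theorem run_copy {B k o t t' n : ℕ} {s : Store} (hko : k ≠ o) (hkt : k ≠ t) (hkt' : k ≠ t')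
    (hot : o ≠ t) (hot' : o ≠ t') (htt : t ≠ t') (h : Fits B s) (hk : s k = num n)
    (ht : s t = []) (ht' : s t' = []) :
    Run B (.copy k o t t') s (update s o (num n)) := by
  have hn : (num n).length ≤ B := hk ▸ h k
  have r1 := run_clear h o
  have r2 := run_drain (l := num n) hkt hkt' htt r1.fits_right (by simp [hko, hk])
    (num_digits n) (by simpa [hot.symm, ht] using hn) (by simpa [hot'.symm, ht'] using hn)
  have r3 := run_clear r2.fits_right t'
  have r4 := run_drain (l := (num n).reverse) hkt.symm hot.symm hko r3.fits_right
    (by simp [htt, hot.symm, ht])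
    (fun x hx => num_digits n x (by simpa using hx))
    (by simpa [hkt', hkt] using hn) (by simpa [hot', hot, hko.symm] using hn)
  refine Run.congr (Run.seq r1 (.seq r2 (.seq r3 r4))) ?_
  funext q
  grind [Function.update_apply]

/-! ### The class of functions computable in polynomial space -/

/-- The functions `ℕⁿ → ℕ` obtained from zero, successor and projections by substitution and by
primitive recursion whose intermediate values have polynomially bounded length. The length of a
number is that of its numeral, and variables are numbered from the innermost binder outwards. -/
inductive PolySpace : {n : ℕ} → ((Fin n → ℕ) → ℕ) → Prop
  | zero : PolySpace fun _ : Fin 0 → ℕ => 0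
  | succ : PolySpace fun a : Fin 1 → ℕ => a 0 + 1
  | proj : PolySpace fun a : Fin 1 → ℕ => a 0
  | rename {m n : ℕ} {f : (Fin m → ℕ) → ℕ} (ρ : Fin m → Fin n) :
      PolySpace f → PolySpace fun a : Fin n → ℕ => f fun i => a (ρ i)
  | subst {n : ℕ} {f : (Fin (n + 1) → ℕ) → ℕ} {g : (Fin n → ℕ) → ℕ} :
      PolySpace f → PolySpace g → PolySpace fun a => f (Matrix.vecCons (g a) a)
  | prec {n : ℕ} {f m : (Fin n → ℕ) → ℕ} {g : (Fin (n + 2) → ℕ) → ℕ} (p : Polynomial ℕ) :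
      PolySpace f → PolySpace g → PolySpace m →
      (∀ (S : ℕ) (a : Fin n → ℕ), (∀ i, (num (a i)).length ≤ S) → ∀ y ≤ m a,
        (num (Nat.rec (f a) (fun y r => g (Matrix.vecCons r (Matrix.vecCons y a))) y)).length ≤
          p.eval S) →
      PolySpace fun a =>
        Nat.rec (f a) (fun y r => g (Matrix.vecCons r (Matrix.vecCons y a))) (m a)

/-- For all stacks `x i` and `o` with names less than `b` there is a program that
overwrites `o` with `f a`, if `a i` is on the stack `x i` and the stacks from `b` on are empty; its
space is polynomial in that of the initial store. -/
def Computes {n : ℕ} (f : (Fin n → ℕ) → ℕ) : Prop :=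
  ∀ (x : Fin n → ℕ) (o b : ℕ), (∀ i, x i < b) → o < b → (∀ i, x i ≠ o) →
    ∃ (c : Cmd) (p : Polynomial ℕ), ∀ (S : ℕ) (s : Store) (a : Fin n → ℕ), Fits S s →
      (∀ i, s (x i) = num (a i)) → (∀ j, b ≤ j → s j = []) →
      Run (p.eval S) c s (update s o (num (f a)))

theorem Computes.subst {n : ℕ} {f : (Fin (n + 1) → ℕ) → ℕ} {g : (Fin n → ℕ) → ℕ}
    (hf : Computes f) (hg : Computes g) : Computes fun a => f (Matrix.vecCons (g a) a) := by
  intro x o b hx ho hxo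
  obtain ⟨cg, pg, Hg⟩ := hg x b (b + 1) (fun i => (hx i).trans b.lt_succ_self) b.lt_succ_self
    (fun i => (hx i).ne)
  obtain ⟨cf, pf, Hf⟩ := hf (Matrix.vecCons b x) o (b + 1)
    (Fin.cases (by simp) fun i => by simpa using (hx i).trans b.lt_succ_self)
    (ho.trans b.lt_succ_self) (Fin.cases (by simpa using ho.ne') fun i => by simpa using hxo i)
  refine ⟨.seq cg (.seq cf (.clear b)), pg + pf.comp pg, fun S s a hS hs he => ?_⟩
  have r1 := Hg S s a hS hs fun j hj => he j (by omega)
  have r2 := Hf _ _ (Matrix.vecCons (g a) a) r1.fits_right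
    (Fin.cases (by simp) fun i => by simp [(hx i).ne, hs])
    (fun j hj => by simp [show j ≠ b by omega, he j (by omega)])
  have r3 := run_clear r2.fits_right b
  simp only [Polynomial.eval_add, Polynomial.eval_comp]
  refine Run.congr (Run.seq (r1.mono (Nat.le_add_right _ _))
    (.seq (r2.mono (Nat.le_add_left _ _)) (r3.mono (Nat.le_add_left _ _)))) ?_
  have := he b le_rfl
  funext q
  grind [Function.update_apply]

theorem Computes.prec {n : ℕ} {f m : (Fin n → ℕ) → ℕ} {g : (Fin (n + 2) → ℕ) → ℕ}
    {p : Polynomial ℕ} (hf : Computes f) (hg : Computes g) (hm : Computes m)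
    (hp : ∀ (S : ℕ) (a : Fin n → ℕ), (∀ i, (num (a i)).length ≤ S) → ∀ y ≤ m a,
      (num (Nat.rec (f a) (fun y r => g (Matrix.vecCons r (Matrix.vecCons y a))) y)).length ≤
        p.eval S) :
    Computes fun a =>
      Nat.rec (f a) (fun y r => g (Matrix.vecCons r (Matrix.vecCons y a))) (m a) := by
  intro x o b hx ho hxo
  have hx1 : ∀ i, x i < b + 1 := fun i => (hx i).trans b.lt_succ_self
  obtain ⟨cm, pm, Hm⟩ := hm x b (b + 1) hx1 b.lt_succ_self (fun i => (hx i).ne)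
  obtain ⟨cf, pf, Hf⟩ := hf x o (b + 1) hx1 (ho.trans b.lt_succ_self) hxo
  obtain ⟨cg, pg, Hg⟩ := hg (Matrix.vecCons o (Matrix.vecCons (b + 1) x)) (b + 2) (b + 3)
    (Fin.cases (by simp; omega) <| Fin.cases (by simp) fun i => by have := hx i; simp; omega)
    (by omega)
    (Fin.cases (by simp; omega) <| Fin.cases (by simp) fun i => by have := hx i; simp; omega)
  -- The stacks `b`, `b + 1` and `b + 2` hold the number of steps to go, the number of steps done
  -- and the next value.
  let body : Cmd := .seq (.dec b (b + 3)) <| .seq cg <| .seq (.copy (b + 2) o (b + 3) (b + 4)) <|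
    .seq (.clear (b + 2)) (.inc (b + 1) (b + 3))
  refine ⟨.seq cm (.seq cf (.seq (.loop b Option.isSome body) (.clear (b + 1)))),
    pm + pf.comp pm + pg.comp (.X + pm + p) + (.X + pm + p + 1), fun S s a hS hs he => ?_⟩
  set R : ℕ → ℕ :=
    fun y => Nat.rec (f a) (fun y r => g (Matrix.vecCons r (Matrix.vecCons y a))) y
  have hRs : ∀ y, R (y + 1) = g (Matrix.vecCons (R y) (Matrix.vecCons y a)) := fun y => rfl
  have hRl : ∀ y ≤ m a, (num (R y)).length ≤ p.eval S :=
    hp S a fun i => hs i ▸ hS (x i)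
  have hR0 : R 0 = f a := rfl
  change Run _ _ s (update s o (num (R (m a))))
  clear_value R
  simp only [Polynomial.eval_add, Polynomial.eval_comp, Polynomial.eval_X, Polynomial.eval_one]
  set Q := S + pm.eval S + p.eval S with hQ
  set B := pm.eval S + pf.eval (pm.eval S) + pg.eval Q + (Q + 1) with hB
  have r1 := Hm S s a hS hs fun j hj => he j (by omega)
  have hml : (num (m a)).length ≤ pm.eval S := by simpa using r1.fits_right b
  have r2 := Hf _ _ a r1.fits_right (fun i => by simp [(hx i).ne, hs])
    (fun j hj => by simp [show j ≠ b by omega, he j (by omega)])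
  let T : ℕ → Store := fun j =>
    update (update (update s o (num (R j))) b (num (m a - j))) (b + 1) (num j)
  have e0 := he b le_rfl
  have e1 := he (b + 1) (by omega)
  have e2 := he (b + 2) (by omega)
  have e3 := he (b + 3) (by omega)
  have e4 := he (b + 4) (by omega)
  have hT : ∀ j ≤ m a, Fits Q (T j) := fun j hj =>
    (((hS.mono (by omega)).update o ((hRl j hj).trans (by omega))).update b
      ((length_num_mono (Nat.sub_le _ _)).trans (hml.trans (by omega)))).update (b + 1)
      ((length_num_mono hj).trans (hml.trans (by omega)))
  have h2 : update (update s b (num (m a))) o (num (f a)) = T 0 := by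
    funext q
    simp only [T, Function.update_apply, hR0, Nat.sub_zero, num_zero]
    grind
  rw [h2] at r2
  have hbody : ∀ j < m a, Run B body (T j) (T (j + 1)) := by
    intro j hj
    have d1 := run_dec (k := b) (t := b + 3) (n := m a - (j + 1)) (by omega) (hT j hj.le)
      (by simp [T, show m a - j = m a - (j + 1) + 1 by omega])
      (by simp [T, e3, show b + 3 ≠ o by omega])
    have f1 : Fits Q (update (T j) b (num (m a - (j + 1)))) := (hT j hj.le).update _
      ((length_num_mono (Nat.sub_le _ _)).trans (hml.trans (by omega)))
    have d2 := Hg Q _ (Matrix.vecCons (R j) (Matrix.vecCons j a)) f1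
      (Fin.cases (by simp [T, ho.ne, show o ≠ b + 1 by omega]) <| Fin.cases (by simp [T])
        fun i => by simp [T, (hx i).ne, (hx1 i).ne, hxo i, hs])
      (fun q hq => by
        simp [T, show q ≠ b by omega, show q ≠ b + 1 by omega, show q ≠ o by omega,
          he q (by omega)])
    rw [← hRs] at d2
    have f2 : Fits Q (update (update (T j) b (num (m a - (j + 1)))) (b + 2) (num (R (j + 1)))) :=
      f1.update _ ((hRl (j + 1) hj).trans (by omega))
    have d3 := run_copy (k := b + 2) (o := o) (t := b + 3) (t' := b + 4) (n := R (j + 1))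
      (by omega) (by omega) (by omega) (by omega) (by omega) (by omega) f2 (by simp)
      (by simp [T, e3, show b + 3 ≠ o by omega]) (by simp [T, e4, show b + 4 ≠ o by omega])
    have d4 := run_clear d3.fits_right (b + 2)
    have d5 := run_inc (k := b + 1) (t := b + 3) (n := j) (by omega) d4.fits_right
      (by simp [T, show b + 1 ≠ o by omega]) (by simp [T, e3, show b + 3 ≠ o by omega])
    refine Run.congr (Run.seq (d1.mono (by omega)) (.seq (d2.mono (by omega))
      (.seq (d3.mono (by omega)) (.seq (d4.mono (by omega)) (d5.mono (by omega)))))) ?_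
    funext q
    simp only [T, Function.update_apply]
    grind
  have r3 : Run B (.loop b Option.isSome body) (T 0) (T (m a)) := by
    refine Run.loop_of_seq T ((hT _ le_rfl).mono (by omega)) (by simp [T, num_zero]) ?_ hbody
    intro j hj
    obtain ⟨d, hd⟩ : ∃ d, m a - j = d + 1 := ⟨m a - j - 1, by omega⟩
    have : (num (d + 1)).length ≠ 0 := by
      rw [length_num]; exact (Nat.log_pos one_lt_two (by omega)).ne'
    simp only [T, hd]
    cases hnum : num (d + 1) with
    | nil => simp [hnum] at this
    | cons => simp
  have r4 := run_clear r3.fits_right (b + 1)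
  refine Run.congr (Run.seq (r1.mono (by omega)) (.seq (r2.mono (by omega)) (.seq r3 r4))) ?_
  funext q
  simp only [T, Function.update_apply, Nat.sub_self, num_zero]
  grind

/-- The functions of the class `PolySpace` can be computed in polynomial space. -/
theorem PolySpace.computes {n : ℕ} {f : (Fin n → ℕ) → ℕ} (h : PolySpace f) : Computes f := by
  induction h with
  | zero =>
    intro x o b _ _ _
    exact ⟨.clear o, .X, fun S s a hS _ _ => by simpa using! run_clear hS o⟩
  | succ =>
    intro x o b hx ho hxo
    refine ⟨.seq (.copy (x 0) o b (b + 1)) (.inc o b), .X + 1, fun S s a hS hs he => ?_⟩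
    have := hx 0
    have r1 := run_copy (hxo 0) (by omega) (by omega) ho.ne (by omega) (by omega) hS (hs 0)
      (he b le_rfl) (he (b + 1) (by omega))
    have r2 := run_inc (k := o) (t := b) ho.ne r1.fits_right (update_self ..)
      (by simp [ho.ne', he b le_rfl])
    simpa using Run.seq (r1.mono S.le_succ) r2
  | proj =>
    intro x o b hx ho hxo
    refine ⟨.copy (x 0) o b (b + 1), .X, fun S s a hS hs he => ?_⟩
    have := hx 0
    simpa using run_copy (hxo 0) (by omega) (by omega) ho.ne (by omega) (by omega) hS (hs 0)
      (he b le_rfl) (he (b + 1) (by omega))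
  | rename ρ _ ih =>
    intro x o b hx ho hxo
    obtain ⟨c, p, h⟩ := ih (fun i => x (ρ i)) o b (fun i => hx _) ho (fun i => hxo _)
    exact ⟨c, p, fun S s a hS hs he => h S s _ hS (fun i => hs _) he⟩
  | subst _ _ hf hg => exact hf.subst hg
  | prec p _ _ _ hp hf hg hm => exact hf.prec hg hm hp

/-- The length of `f a` is polynomially bounded in the lengths of the `a i`. -/
theorem PolySpace.exists_length_le {n : ℕ} {f : (Fin n → ℕ) → ℕ} (h : PolySpace f) :
    ∃ p : Polynomial ℕ, ∀ (S : ℕ) (a : Fin n → ℕ), (∀ i, (num (a i)).length ≤ S) →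
      (num (f a)).length ≤ p.eval S := by
  obtain ⟨c, p, hc⟩ := h.computes (fun i => i) n (n + 1) (fun i => by omega) (by omega)
    (fun i => by omega)
  refine ⟨p, fun S a ha => ?_⟩
  have r := hc S (fun j => if hj : j < n then num (a ⟨j, hj⟩) else []) a
    (fun j => by dsimp only; split_ifs <;> simp [ha]) (fun i => by simp)
    (fun j hj => by simp [show ¬ j < n by omega])
  simpa using r.fits_right n

/-! ### Closure properties of the class -/

/-- A predicate on `ℕⁿ` is decided by a function of the class `PolySpace`, zero meaning false. -/
def PolySpacePred {n : ℕ} (P : (Fin n → ℕ) → Prop) : Prop :=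
  ∃ f : (Fin n → ℕ) → ℕ, PolySpace f ∧ ∀ a, P a ↔ f a ≠ 0

namespace PolySpace

variable {n : ℕ}

theorem var (i : Fin n) : PolySpace fun a => a i :=
  PolySpace.proj.rename fun _ => i

theorem comp_aux {k n N : ℕ} {G : Fin k → (Fin n → ℕ) → ℕ} (hG : ∀ j, PolySpace (G j))
    {f : (Fin N → ℕ) → ℕ} (hf : PolySpace f) (ρ : Fin N → Fin k ⊕ Fin n) :
    PolySpace fun a => f fun i => Sum.elim (fun j => G j a) a (ρ i) := by
  induction k generalizing n with
  | zero =>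
    have := hf.rename fun i => Sum.elim (fun j => j.elim0) id (ρ i)
    convert this using 3 with a
    funext i
    rcases ρ i with j | j
    exacts [j.elim0, rfl]
  | succ k ih =>
    -- The first function is substituted for a new variable `0`.
    have h := ih (n := n + 1) (G := fun j a => G j.succ fun i => a i.succ)
      (fun j => (hG j.succ).rename Fin.succ)
      (fun i => Sum.elim (Fin.cases (.inr 0) .inl) (fun j => .inr j.succ) (ρ i))
    have h' := h.subst (hG 0)
    convert h' using 3 with a
    funext i
    rcases ρ i with j | j
    · cases j using Fin.cases <;> rfl
    · rfl

/-- The class is closed under composition. -/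
theorem comp {m : ℕ} {f : (Fin m → ℕ) → ℕ} (hf : PolySpace f) {G : Fin m → (Fin n → ℕ) → ℕ}
    (hG : ∀ j, PolySpace (G j)) : PolySpace fun a => f fun j => G j a :=
  comp_aux hG hf .inl

theorem comp₁ {F : ℕ → ℕ} (hF : PolySpace fun a : Fin 1 → ℕ => F (a 0)) {f : (Fin n → ℕ) → ℕ}
    (hf : PolySpace f) : PolySpace fun a => F (f a) :=
  hF.comp (G := ![f]) (by simpa [Fin.forall_fin_succ] using hf)

theorem comp₂ {F : ℕ → ℕ → ℕ} (hF : PolySpace fun a : Fin 2 → ℕ => F (a 0) (a 1))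
    {f g : (Fin n → ℕ) → ℕ} (hf : PolySpace f) (hg : PolySpace g) :
    PolySpace fun a => F (f a) (g a) :=
  hF.comp (G := ![f, g]) (by simpa [Fin.forall_fin_succ] using ⟨hf, hg⟩)

theorem comp₃ {F : ℕ → ℕ → ℕ → ℕ} (hF : PolySpace fun a : Fin 3 → ℕ => F (a 0) (a 1) (a 2))
    {f g h : (Fin n → ℕ) → ℕ} (hf : PolySpace f) (hg : PolySpace g) (hh : PolySpace h) :
    PolySpace fun a => F (f a) (g a) (h a) :=
  hF.comp (G := ![f, g, h]) (by simpa [Fin.forall_fin_succ] using ⟨hf, hg, hh⟩)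

theorem const (c : ℕ) : PolySpace fun _ : Fin n → ℕ => c := by
  induction c with
  | zero => exact PolySpace.zero.rename Fin.elim0
  | succ c ih => exact comp₁ (F := fun x => x + 1) PolySpace.succ ih

/-- Limited recursion: a primitive recursion whose values are bounded by a function of the class
does not leave the class. -/
theorem limitedRec {f m h : (Fin n → ℕ) → ℕ} {g : (Fin n → ℕ) → ℕ → ℕ → ℕ} (hf : PolySpace f)
    (hg : PolySpace fun v : Fin (n + 2) → ℕ => g (fun i => v i.succ.succ) (v 1) (v 0))
    (hm : PolySpace m) (hh : PolySpace h)
    (hle : ∀ a, ∀ y ≤ m a, Nat.rec (f a) (fun y r => g a y r) y ≤ h a) :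
    PolySpace fun a => Nat.rec (f a) (fun y r => g a y r) (m a) := by
  obtain ⟨p, hp⟩ := hh.exists_length_le
  exact PolySpace.prec p hf hg hm fun S a ha y hy =>
    (length_num_mono (hle a y hy)).trans (hp S a ha)

theorem add {f g : (Fin n → ℕ) → ℕ} (hf : PolySpace f) (hg : PolySpace g) :
    PolySpace fun a => f a + g a := by
  refine comp₂ (F := fun x y => x + y) ?_ hf hg
  have h : ∀ x y : ℕ, Nat.rec x (fun _ r => r + 1) y = x + y := fun x y => by
    induction y with
    | zero => rfl
    | succ y ih => rw [← add_assoc, ← ih]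
  have := PolySpace.prec (n := 2) (f := fun a => a 0) (g := fun a => a 0 + 1) (m := fun a => a 1)
    (.X + 1) (var 0) (comp₁ (F := fun x => x + 1) PolySpace.succ (var 0)) (var 1) (by
      intro S a ha y hy
      change (num (Nat.rec (a 0) (fun _ r => r + 1) y)).length ≤ _
      rw [h, Polynomial.eval_add, Polynomial.eval_X, Polynomial.eval_one]
      refine (length_num_mono (n := 2 * max (a 0) (a 1) + 1) (by omega)).trans ?_
      rw [length_num, show 2 * max (a 0) (a 1) + 1 + 1 = (max (a 0) (a 1) + 1) * 2 by ring,
        Nat.log_mul_base one_lt_two (by omega), ← length_num]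
      rcases max_choice (a 0) (a 1) with e | e <;> rw [e]
      exacts [Nat.succ_le_succ (ha 0), Nat.succ_le_succ (ha 1)])
  convert this using 2 with a
  exact (h (a 0) (a 1)).symm

theorem pred {f : (Fin n → ℕ) → ℕ} (hf : PolySpace f) : PolySpace fun a => f a - 1 := by
  refine comp₁ (F := fun x => x - 1) ?_ hf
  have h : ∀ x : ℕ, Nat.rec 0 (fun y _ => y) x = x - 1 := fun x => by cases x <;> rfl
  have := limitedRec (n := 1) (f := fun _ => 0) (g := fun _ y _ => y) (m := fun a => a 0)
    (const 0) (var 1) (var 0) (var 0) (fun a y hy => by rw [h]; omega)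
  convert this using 2 with a
  exact (h (a 0)).symm

theorem sub {f g : (Fin n → ℕ) → ℕ} (hf : PolySpace f) (hg : PolySpace g) :
    PolySpace fun a => f a - g a := by
  refine comp₂ (F := fun x y => x - y) ?_ hf hg
  have h : ∀ x y : ℕ, Nat.rec x (fun _ r => r - 1) y = x - y := fun x y => by
    induction y with
    | zero => rfl
    | succ y ih => rw [← Nat.sub_sub, ← ih]
  have := limitedRec (n := 2) (f := fun a => a 0) (g := fun _ _ r => r - 1) (m := fun a => a 1)
    (var 0) (pred (var 0)) (var 1) (var 0) (fun a y hy => by rw [h]; omega)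
  convert this using 2 with a
  exact (h (a 0) (a 1)).symm

theorem mul {f g : (Fin n → ℕ) → ℕ} (hf : PolySpace f) (hg : PolySpace g) :
    PolySpace fun a => f a * g a := by
  refine comp₂ (F := fun x y => x * y) ?_ hf hg
  have h : ∀ x y : ℕ, Nat.rec 0 (fun _ r => r + x) y = x * y := fun x y => by
    induction y with
    | zero => rfl
    | succ y ih => rw [mul_add, mul_one, ← ih]
  have := PolySpace.prec (n := 2) (f := fun a => 0) (g := fun a => a 0 + a 2) (m := fun a => a 1)
    (.X + .X + 1) (const 0) ((var 0).add (var 2)) (var 1) (by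
      intro S a ha y hy
      change (num (Nat.rec 0 (fun _ r => r + a 0) y)).length ≤ _
      rw [h, Polynomial.eval_add, Polynomial.eval_add, Polynomial.eval_X, Polynomial.eval_one]
      have h0 := ha 0
      have h1 := (length_num_mono hy).trans (ha 1)
      rw [length_num] at h0 h1 ⊢
      have e0 := Nat.lt_pow_succ_log_self one_lt_two (a 0 + 1)
      have e1 := Nat.lt_pow_succ_log_self one_lt_two (y + 1)
      refine Nat.lt_succ_iff.1 (Nat.log_lt_of_lt_pow (by omega) ?_)
      calc a 0 * y + 1 ≤ (a 0 + 1) * (y + 1) := by nlinarith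
        _ < _ := Nat.mul_lt_mul'' e0 e1
        _ = 2 ^ (Nat.log 2 (a 0 + 1) + 1 + (Nat.log 2 (y + 1) + 1)) := (pow_add ..).symm
        _ ≤ _ := Nat.pow_le_pow_right two_pos (by omega))
  convert this using 2 with a
  exact (h (a 0) (a 1)).symm

/-- Definition by cases. -/
theorem ite {P : (Fin n → ℕ) → Prop} [DecidablePred P] {f g : (Fin n → ℕ) → ℕ}
    (hP : PolySpacePred P) (hf : PolySpace f) (hg : PolySpace g) :
    PolySpace fun a => if P a then f a else g a := by
  obtain ⟨c, hc, hPc⟩ := hP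
  have := limitedRec (f := g) (g := fun a _ _ => f a) (m := c) (h := fun a => f a + g a)
    hg (hf.rename fun i => i.succ.succ) hc (hf.add hg) (fun a y _ => by cases y <;> simp)
  convert this using 2 with a
  by_cases h : c a = 0
  · simp only [if_neg (fun hp => (hPc a).1 hp h), h]
    rfl
  · obtain ⟨y, hy⟩ := Nat.exists_eq_succ_of_ne_zero h
    simp only [if_pos ((hPc a).2 h), hy]

end PolySpace

namespace PolySpacePred

variable {n : ℕ}

theorem congr {P Q : (Fin n → ℕ) → Prop} (hP : PolySpacePred P) (h : ∀ a, Q a ↔ P a) :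
    PolySpacePred Q := by
  obtain ⟨f, hf, hPf⟩ := hP
  exact ⟨f, hf, fun a => (h a).trans (hPf a)⟩

theorem rename {m n : ℕ} {P : (Fin m → ℕ) → Prop} (hP : PolySpacePred P) (ρ : Fin m → Fin n) :
    PolySpacePred fun a : Fin n → ℕ => P fun i => a (ρ i) := by
  obtain ⟨f, hf, hPf⟩ := hP
  exact ⟨_, hf.rename ρ, fun a => hPf _⟩

theorem comp {m : ℕ} {P : (Fin m → ℕ) → Prop} (hP : PolySpacePred P)
    {G : Fin m → (Fin n → ℕ) → ℕ} (hG : ∀ j, PolySpace (G j)) :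
    PolySpacePred fun a => P fun j => G j a := by
  obtain ⟨f, hf, hPf⟩ := hP
  exact ⟨_, hf.comp hG, fun a => hPf _⟩

theorem lt {f g : (Fin n → ℕ) → ℕ} (hf : PolySpace f) (hg : PolySpace g) :
    PolySpacePred fun a => f a < g a :=
  ⟨_, hg.sub hf, fun a => by omega⟩

theorem not {P : (Fin n → ℕ) → Prop} (hP : PolySpacePred P) : PolySpacePred fun a => ¬ P a := by
  obtain ⟨f, hf, hPf⟩ := hP
  exact ⟨_, (PolySpace.const 1).sub hf, fun a => by dsimp only; rw [hPf, not_ne_iff]; omega⟩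

theorem and {P Q : (Fin n → ℕ) → Prop} (hP : PolySpacePred P) (hQ : PolySpacePred Q) :
    PolySpacePred fun a => P a ∧ Q a := by
  obtain ⟨f, hf, hPf⟩ := hP
  obtain ⟨g, hg, hQg⟩ := hQ
  exact ⟨_, hf.mul hg, fun a => by dsimp only; rw [hPf, hQg, mul_ne_zero_iff]⟩

theorem or {P Q : (Fin n → ℕ) → Prop} (hP : PolySpacePred P) (hQ : PolySpacePred Q) :
    PolySpacePred fun a => P a ∨ Q a :=
  (hP.not.and hQ.not).not.congr fun a => by tauto

theorem le {f g : (Fin n → ℕ) → ℕ} (hf : PolySpace f) (hg : PolySpace g) :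
    PolySpacePred fun a => f a ≤ g a :=
  (lt hg hf).not.congr fun a => by omega

theorem eq {f g : (Fin n → ℕ) → ℕ} (hf : PolySpace f) (hg : PolySpace g) :
    PolySpacePred fun a => f a = g a :=
  ((le hf hg).and (le hg hf)).congr fun a => by omega

theorem exists_lt {P : (Fin n → ℕ) → ℕ → Prop} {m : (Fin n → ℕ) → ℕ} (hm : PolySpace m)
    (hP : PolySpacePred fun v : Fin (n + 1) → ℕ => P (fun i => v i.succ) (v 0)) :
    PolySpacePred fun a => ∃ x < m a, P a x := by
  classical
  have hP' : PolySpacePred fun v : Fin (n + 2) → ℕ => P (fun i => v i.succ.succ) (v 1) :=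
    hP.rename Fin.succ
  have hle : ∀ a, ∀ y, Nat.rec 0 (fun y r => if P a y then 1 else r) y ≤ 1 := by
    intro a y
    induction y with
    | zero => exact zero_le_one
    | succ y ih => dsimp only; split_ifs; exacts [le_rfl, ih]
  refine ⟨_, PolySpace.limitedRec (f := fun _ => 0) (g := fun a y r => if P a y then 1 else r)
    (h := fun _ => 1) (.const 0) (.ite hP' (.const 1) (.var 0)) hm (.const 1)
    (fun a y _ => hle a y), fun a => ?_⟩
  dsimp only
  generalize m a = k
  induction k with
  | zero => simp
  | succ k ih =>
    have : (∃ x < k + 1, P a x) ↔ P a k ∨ ∃ x < k, P a x := by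
      simp only [Nat.lt_succ_iff_lt_or_eq]
      constructor
      · rintro ⟨x, hx | rfl, h⟩
        exacts [.inr ⟨x, hx, h⟩, .inl h]
      · rintro (h | ⟨x, hx, h⟩)
        exacts [⟨k, .inr rfl, h⟩, ⟨x, .inl hx, h⟩]
    rw [this, ih]
    by_cases h : P a k <;> simp [h]

theorem forall_lt {P : (Fin n → ℕ) → ℕ → Prop} {m : (Fin n → ℕ) → ℕ} (hm : PolySpace m)
    (hP : PolySpacePred fun v : Fin (n + 1) → ℕ => P (fun i => v i.succ) (v 0)) :
    PolySpacePred fun a => ∀ x < m a, P a x :=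
  (exists_lt (P := fun a x => ¬ P a x) hm hP.not).not.congr fun a => by push Not; rfl

end PolySpacePred

namespace PolySpace

variable {n : ℕ}

theorem findGreatest {P : (Fin n → ℕ) → ℕ → Prop} [∀ a, DecidablePred (P a)]
    {m : (Fin n → ℕ) → ℕ} (hm : PolySpace m)
    (hP : PolySpacePred fun v : Fin (n + 1) → ℕ => P (fun i => v i.succ) (v 0)) :
    PolySpace fun a => Nat.findGreatest (P a) (m a) := by
  have h : ∀ a y, Nat.rec 0 (fun y r => if P a (y + 1) then y + 1 else r) y =
      Nat.findGreatest (P a) y := fun a y => by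
    induction y with
    | zero => rfl
    | succ y ih => rw [Nat.findGreatest_succ, ← ih]
  have hP' : PolySpacePred fun v : Fin (n + 2) → ℕ => P (fun i => v i.succ.succ) (v 1 + 1) :=
    hP.comp (G := Matrix.vecCons (fun v => v 1 + 1) fun i v => v i.succ.succ)
      (Fin.cases ((var 1).add (const 1)) fun i => var _)
  have := limitedRec (f := fun _ => 0) (g := fun a y r => if P a (y + 1) then y + 1 else r)
    (const 0) (ite hP' ((var 1).add (const 1)) (var 0)) hm hm
    (fun a y hy => by rw [h]; exact (Nat.findGreatest_le y).trans hy)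
  convert this using 2 with a
  exact (h a (m a)).symm

theorem div {f g : (Fin n → ℕ) → ℕ} (hf : PolySpace f) (hg : PolySpace g) :
    PolySpace fun a => f a / g a := by
  refine comp₂ (F := fun x y => x / y) ?_ hf hg
  have := ite (P := fun a : Fin 2 → ℕ => a 1 = 0) (f := fun _ => 0)
    (.eq (var 1) (const 0)) (const 0)
    (findGreatest (P := fun a k => k * a 1 ≤ a 0) (var 0) (.le ((var 0).mul (var 2)) (var 1)))
  convert this using 2 with a
  split_ifs with h
  · simp [h]
  · have h0 : 0 < a 1 := Nat.pos_of_ne_zero h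
    refine ((Nat.findGreatest_eq_iff (P := fun k => k * a 1 ≤ a 0)).2
      ⟨Nat.div_le_self _ _, fun _ => Nat.div_mul_le_self _ _, fun k hk _ hle => ?_⟩).symm
    exact absurd ((Nat.le_div_iff_mul_le h0).2 hle) (not_le.2 hk)

theorem mod {f g : (Fin n → ℕ) → ℕ} (hf : PolySpace f) (hg : PolySpace g) :
    PolySpace fun a => f a % g a := by
  have := hf.sub (hg.mul (hf.div hg))
  convert this using 2 with a
  exact Nat.mod_eq_sub_mul_div

/-- The quotient by a power is obtained by repeated division, whose values decrease. -/
theorem div_pow {f g h : (Fin n → ℕ) → ℕ} (hf : PolySpace f) (hg : PolySpace g)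
    (hh : PolySpace h) : PolySpace fun a => f a / g a ^ h a := by
  refine comp₃ (F := fun x y z => x / y ^ z) ?_ hf hg hh
  have e : ∀ x y z : ℕ, Nat.rec x (fun _ r => r / y) z = x / y ^ z := fun x y z => by
    induction z with
    | zero => simp
    | succ z ih => rw [pow_succ, ← Nat.div_div_eq_div_mul, ← ih]
  have := limitedRec (n := 3) (f := fun a => a 0) (g := fun a _ r => r / a 1) (m := fun a => a 2)
    (var 0) (div (var 0) (var 3)) (var 2) (var 0)
    (fun a y _ => by rw [e]; exact Nat.div_le_self _ _)
  convert this using 2 with a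
  exact (e (a 0) (a 1) (a 2)).symm

theorem log {f : (Fin n → ℕ) → ℕ} (hf : PolySpace f) : PolySpace fun a => Nat.log 2 (f a) := by
  refine comp₁ (F := fun x => Nat.log 2 x) ?_ hf
  have := findGreatest (n := 1) (P := fun a k => 0 < a 0 / 2 ^ k) (var 0)
    (.lt (const 0) (div_pow (var 1) (const 2) (var 0)))
  convert this using 2 with a
  rcases Nat.eq_zero_or_pos (a 0) with h | h
  · simp [h]
  · refine (Nat.findGreatest_eq_iff.2 ⟨Nat.log_le_self _ _, fun _ => ?_, fun k hk _ => ?_⟩).symm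
    · exact Nat.div_pos (Nat.pow_log_le_self _ h.ne') (by positivity)
    · rw [Nat.div_eq_of_lt (Nat.lt_pow_of_log_lt one_lt_two hk)]; exact lt_irrefl _

theorem length_num {f : (Fin n → ℕ) → ℕ} (hf : PolySpace f) :
    PolySpace fun a => (num (f a)).length := by
  simpa only [SpaceBounded.length_num] using log (hf.add (const 1))

/-- Powers with exponents of logarithmic size, the source of superpolynomial growth within the
class. -/
theorem pow_length {f g : (Fin n → ℕ) → ℕ} (hf : PolySpace f) (hg : PolySpace g) :
    PolySpace fun a => f a ^ (num (g a)).length := by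
  refine comp₂ (F := fun x y => x ^ (num y).length) ?_ hf hg
  have e : ∀ x y : ℕ, Nat.rec 1 (fun _ r => r * x) y = x ^ y := fun x y => by
    induction y with
    | zero => rfl
    | succ y ih => rw [pow_succ, ← ih]
  have := PolySpace.prec (n := 2) (f := fun a => 1) (g := fun a => a 0 * a 2)
    (m := fun a => (num (a 1)).length) (.X * (.X + 1) + 1) (const 1) ((var 0).mul (var 2))
    (length_num (var 1)) (by
      intro S a ha y hy
      change (num (Nat.rec 1 (fun _ r => r * a 0) y)).length ≤ _
      rw [e, Polynomial.eval_add, Polynomial.eval_mul, Polynomial.eval_add, Polynomial.eval_X,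
        Polynomial.eval_one]
      have h0 := ha 0
      have h1 := hy.trans (ha 1)
      rw [SpaceBounded.length_num] at h0 ⊢
      have e0 := Nat.lt_pow_succ_log_self one_lt_two (a 0 + 1)
      refine Nat.lt_succ_iff.1 (Nat.log_lt_of_lt_pow (by omega) ?_)
      calc a 0 ^ y + 1 ≤ (2 ^ (S + 1)) ^ S + 1 := by
            refine Nat.succ_le_succ ((Nat.pow_le_pow_left (m := 2 ^ (S + 1)) ?_ y).trans
              (Nat.pow_le_pow_right (by positivity) h1))
            have := Nat.pow_le_pow_right two_pos (Nat.succ_le_succ h0)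
            omega
        _ < 2 ^ ((S + 1) * S + 2) := by
            rw [← pow_mul, pow_add]
            have := Nat.one_le_two_pow (n := (S + 1) * S)
            omega
        _ = _ := by rw [Nat.succ_eq_add_one]; ring)
  convert this using 2 with a
  exact (e _ _).symm

theorem pair {f g : (Fin n → ℕ) → ℕ} (hf : PolySpace f) (hg : PolySpace g) :
    PolySpace fun a => Nat.pair (f a) (g a) :=
  ite (.lt hf hg) ((hg.mul hg).add hf) (((hf.mul hf).add hf).add hg)

theorem sqrt {f : (Fin n → ℕ) → ℕ} (hf : PolySpace f) : PolySpace fun a => Nat.sqrt (f a) := by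
  refine comp₁ (F := fun x => Nat.sqrt x) ?_ hf
  have := findGreatest (n := 1) (P := fun a k => k * k ≤ a 0) (var 0)
    (.le ((var 0).mul (var 0)) (var 1))
  convert this using 2 with a
  refine ((Nat.findGreatest_eq_iff (P := fun k => k * k ≤ a 0)).2
    ⟨Nat.sqrt_le_self _, fun _ => Nat.sqrt_le _, fun k hk _ hle => ?_⟩).symm
  exact absurd (Nat.le_sqrt.2 hle) (not_le.2 hk)

theorem unpair_fst {f : (Fin n → ℕ) → ℕ} (hf : PolySpace f) :
    PolySpace fun a => (Nat.unpair (f a)).1 := by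
  have hs := hf.sqrt
  have hd := hf.sub (hs.mul hs)
  convert ite (.lt hd hs) hd hs using 2 with a
  unfold Nat.unpair
  dsimp only
  split_ifs <;> rfl

theorem unpair_snd {f : (Fin n → ℕ) → ℕ} (hf : PolySpace f) :
    PolySpace fun a => (Nat.unpair (f a)).2 := by
  have hs := hf.sqrt
  have hd := hf.sub (hs.mul hs)
  convert ite (.lt hd hs) hs (hd.sub hs) using 2 with a
  unfold Nat.unpair
  dsimp only
  split_ifs <;> rfl

theorem min {f g : (Fin n → ℕ) → ℕ} (hf : PolySpace f) (hg : PolySpace g) :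
    PolySpace fun a => Min.min (f a) (g a) := by
  convert ite (.le hf hg) hf hg using 2 with a
  exact min_def _ _

end PolySpace

/-! ### Reachability in exponentially large graphs -/

/-- `MidPath E W d u v`: there is a path of length at most `2 ^ d` from `u` to `v` in the graph
`E`, found by repeated bisection with midpoints below `W`. -/
def MidPath (E : ℕ → ℕ → Prop) (W : ℕ) : ℕ → ℕ → ℕ → Prop
  | 0, u, v => u = v ∨ E u v
  | d + 1, u, v => ∃ x < W, MidPath E W d u x ∧ MidPath E W d x v

theorem MidPath.reflTransGen {E : ℕ → ℕ → Prop} {W d u v : ℕ} (hv : v < W)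
    (h : MidPath E W d u v) : Relation.ReflTransGen (fun x y => E x y ∧ y < W) u v := by
  induction d generalizing u v with
  | zero =>
    rcases h with rfl | h
    exacts [.refl, .single ⟨h, hv⟩]
  | succ d ih =>
    obtain ⟨x, hx, h₁, h₂⟩ := h
    exact (ih hx h₁).trans (ih hv h₂)

theorem midPath_of_walk {E : ℕ → ℕ → Prop} {W d i n : ℕ} {f : ℕ → ℕ} (hn : n ≤ 2 ^ d)
    (hE : ∀ j < n, E (f (i + j)) (f (i + (j + 1)))) (hW : ∀ j ≤ n, f (i + j) < W) :
    MidPath E W d (f i) (f (i + n)) := by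
  induction d generalizing i n with
  | zero =>
    obtain rfl | rfl : n = 0 ∨ n = 1 := by simp only [pow_zero] at hn; omega
    · exact .inl rfl
    · exact .inr (hE 0 one_pos)
  | succ d ih =>
    obtain ⟨k, l, rfl, hk, hl⟩ : ∃ k l, n = k + l ∧ k ≤ 2 ^ d ∧ l ≤ 2 ^ d :=
      ⟨min n (2 ^ d), n - min n (2 ^ d), by omega, by omega, by rw [pow_succ] at hn; omega⟩
    refine ⟨f (i + k), hW k (by omega), ih hk (fun j hj => hE j (by omega))
      (fun j hj => hW j (by omega)), ?_⟩
    rw [← add_assoc]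
    refine ih hl (fun j hj => ?_) (fun j hj => ?_)
    · have := hE (k + j) (by omega)
      rwa [← add_assoc, show i + (k + j + 1) = i + k + (j + 1) by ring] at this
    · rw [add_assoc]; exact hW (k + j) (by omega)

/-- A vertex that can be reached at all can be reached by a walk shorter than the number of
vertices, because a shortest walk visits no vertex twice. -/
theorem exists_short_walk {E : ℕ → ℕ → Prop} {W u v : ℕ} (hu : u < W)
    (h : Relation.ReflTransGen (fun x y => E x y ∧ y < W) u v) :
    ∃ (n : ℕ) (f : ℕ → ℕ), n < W ∧ f 0 = u ∧ f n = v ∧ (∀ j < n, E (f j) (f (j + 1))) ∧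
      ∀ j ≤ n, f j < W := by
  classical
  let P : ℕ → Prop := fun n => ∃ f : ℕ → ℕ, f 0 = u ∧ f n = v ∧ (∀ j < n, E (f j) (f (j + 1))) ∧
    ∀ j ≤ n, f j < W
  have hex : ∃ n, P n := by
    induction h with
    | refl => exact ⟨0, fun _ => u, rfl, rfl, by simp, by simpa using hu⟩
    | @tail b c _ hbc ih =>
      obtain ⟨n, f, h0, hn, hE, hW⟩ := ih
      refine ⟨n + 1, fun j => if j ≤ n then f j else c, by simpa using h0, by simp, ?_, ?_⟩
      · intro j hj
        rcases Nat.lt_succ_iff_lt_or_eq.1 hj with hj' | rfl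
        · simpa [hj'.le, Nat.succ_le_of_lt hj'] using hE j hj'
        · simpa [hn] using hbc.1
      · intro j hj
        dsimp only
        split_ifs with hjn
        exacts [hW j hjn, hbc.2]
  obtain ⟨f, h0, hn, hE, hW⟩ := Nat.find_spec hex
  refine ⟨Nat.find hex, f, ?_, h0, hn, hE, hW⟩
  by_contra! hle
  obtain ⟨i, j, hij, hfij⟩ : ∃ i j : Fin (Nat.find hex + 1), i < j ∧ f i = f j := by
    obtain ⟨i, j, hne, he⟩ := Fintype.exists_ne_map_eq_of_card_lt
      (fun i : Fin (Nat.find hex + 1) => (⟨f i, hW i (Nat.lt_succ_iff.1 i.is_lt)⟩ : Fin W))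
      (by simp only [Fintype.card_fin]; omega)
    rw [Fin.mk.injEq] at he
    rcases lt_or_gt_of_ne hne with h | h
    exacts [⟨i, j, h, he⟩, ⟨j, i, h, he.symm⟩]
  have hij' : (i : ℕ) < j := hij
  have hj := j.is_lt
  -- The loop between the two visits is cut out.
  have hmin := Nat.find_min hex (m := Nat.find hex - (j - i)) (by omega)
  refine hmin ⟨fun k => if k ≤ i then f k else f (k + (j - i)), by simpa using h0, ?_, ?_, ?_⟩
  · dsimp only
    split_ifs with hk
    · rw [show Nat.find hex - (j - i) = (i : ℕ) by omega, hfij,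
        show (j : ℕ) = Nat.find hex by omega, hn]
    · rw [show Nat.find hex - (j - i) + (j - i) = Nat.find hex by omega, hn]
  · intro k hk
    dsimp only
    split_ifs with h₁ h₂
    · exact hE k (by omega)
    · have hki : k = i := by omega
      rw [hki, hfij, show (i : ℕ) + 1 + (j - i) = j + 1 by omega]
      exact hE j (by omega)
    · omega
    · rw [show k + 1 + (j - i) = k + (j - i) + 1 by omega]
      exact hE _ (by omega)
  · intro k hk
    dsimp only
    split_ifs
    exacts [hW k (by omega), hW _ (by omega)]

theorem midPath_iff_reflTransGen {E : ℕ → ℕ → Prop} {W d u v : ℕ} (hu : u < W) (hv : v < W)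
    (hd : W ≤ 2 ^ d) :
    MidPath E W d u v ↔ Relation.ReflTransGen (fun x y => E x y ∧ y < W) u v := by
  refine ⟨fun h => h.reflTransGen hv, fun h => ?_⟩
  obtain ⟨n, f, hn, rfl, rfl, hE, hW⟩ := exists_short_walk hu h
  simpa using midPath_of_walk (i := 0) (d := d) (hn.le.trans hd) (by simpa using hE)
    (by simpa using hW)

/-! The bisection is a recursion with two calls, over all midpoints. It is carried out by a machine
with an explicit stack, whose states are natural numbers, so that the recursion becomes the
iteration of a single function. -/

/-- The state of the bisection machine with mode `m` (`0`: evaluate `MidPath E W l u v`, `1`: return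
the value false, `2`: return the value true), current level `l` and stack `s`. -/
def bisectState (m u v l s : ℕ) : ℕ := Nat.pair m (Nat.pair u (Nat.pair v (Nat.pair l s)))

/-- Push on the stack `s`, a number written in base `B`, the frame of a pending evaluation between
`u` and `v` with midpoint `x`, whose half number `h` (`0` or `1`) is being evaluated. -/
def pushFrame (B s u v x h : ℕ) : ℕ := (((s * B + u) * B + v) * B + x) * B + h

open Classical in
/-- The mode of the bisection machine that returns the truth value of `p`. -/
noncomputable def answer (p : Prop) : ℕ := if p then 2 else 1

theorem answer_true {p : Prop} (h : p) : answer p = 2 := if_pos h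

theorem answer_false {p : Prop} (h : ¬ p) : answer p = 1 := if_neg h

/-- One step of the bisection machine. The evaluation at the top level is `D`. -/
noncomputable def bisectStep (E : ℕ → ℕ → Prop) (W D z : ℕ) : ℕ :=
  let m := z.unpair.1
  let u := z.unpair.2.unpair.1
  let v := z.unpair.2.unpair.2.unpair.1
  let l := z.unpair.2.unpair.2.unpair.2.unpair.1
  let s := z.unpair.2.unpair.2.unpair.2.unpair.2
  let B := W + 2
  let h := s % B
  let x := s / B % B
  let v' := s / B / B % B
  let u' := s / B / B / B % B
  let s' := s / B / B / B / B
  if m = 0 then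
    if l = 0 then bisectState (answer (u = v ∨ E u v)) 0 0 0 s
    else bisectState 0 u 0 (l - 1) (pushFrame B s u v 0 0)
  else if l = D then z
  else if m = 2 then
    if h = 0 then bisectState 0 x v' l (pushFrame B s' u' v' x 1)
    else bisectState 2 0 0 (l + 1) s'
  else if x + 1 < W then bisectState 0 u' (x + 1) l (pushFrame B s' u' v' (x + 1) 0)
  else bisectState 1 0 0 (l + 1) s'

theorem polySpace_answer {n : ℕ} {P : (Fin n → ℕ) → Prop} (hP : PolySpacePred P) :
    PolySpace fun a => answer (P a) := by
  unfold answer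
  exact @PolySpace.ite _ _ (fun _ => Classical.propDecidable _) _ _ hP (.const 2) (.const 1)

theorem polySpace_bisectState {n : ℕ} {m u v l s : (Fin n → ℕ) → ℕ} (hm : PolySpace m)
    (hu : PolySpace u) (hv : PolySpace v) (hl : PolySpace l) (hs : PolySpace s) :
    PolySpace fun a => bisectState (m a) (u a) (v a) (l a) (s a) :=
  hm.pair (hu.pair (hv.pair (hl.pair hs)))

theorem polySpace_pushFrame {n : ℕ} {B s u v x h : (Fin n → ℕ) → ℕ} (hB : PolySpace B)
    (hs : PolySpace s) (hu : PolySpace u) (hv : PolySpace v) (hx : PolySpace x)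
    (hh : PolySpace h) : PolySpace fun a => pushFrame (B a) (s a) (u a) (v a) (x a) (h a) :=
  ((((((((hs.mul hB).add hu).mul hB).add hv).mul hB).add hx).mul hB).add hh)

theorem polySpace_bisectStep {n : ℕ} {E : (Fin n → ℕ) → ℕ → ℕ → Prop} {W D z : (Fin n → ℕ) → ℕ}
    (hE : PolySpacePred fun v : Fin (n + 2) → ℕ => E (fun i => v i.succ.succ) (v 1) (v 0))
    (hW : PolySpace W) (hD : PolySpace D) (hz : PolySpace z) :
    PolySpace fun a => bisectStep (E a) (W a) (D a) (z a) := by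
  have hm := hz.unpair_fst
  have hu := hz.unpair_snd.unpair_fst
  have hv := hz.unpair_snd.unpair_snd.unpair_fst
  have hl := hz.unpair_snd.unpair_snd.unpair_snd.unpair_fst
  have hs := hz.unpair_snd.unpair_snd.unpair_snd.unpair_snd
  have hB := hW.add (.const 2)
  have hs1 := hs.div hB
  have hs2 := hs1.div hB
  have hs3 := hs2.div hB
  have hs4 := hs3.div hB
  have hh := hs.mod hB
  have hx := hs1.mod hB
  have hv' := hs2.mod hB
  have hu' := hs3.mod hB
  have c0 : PolySpace fun _ : Fin n → ℕ => 0 := .const 0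
  have c1 : PolySpace fun _ : Fin n → ℕ => 1 := .const 1
  have c2 : PolySpace fun _ : Fin n → ℕ => 2 := .const 2
  have hx1 := hx.add c1
  have hE' : PolySpacePred fun a => E a (z a).unpair.2.unpair.1
      (z a).unpair.2.unpair.2.unpair.1 := hE.comp
    (G := Matrix.vecCons (fun a => (z a).unpair.2.unpair.2.unpair.1)
      (Matrix.vecCons (fun a => (z a).unpair.2.unpair.1) fun i a => a i))
    (Fin.cases hv <| Fin.cases hu fun i => .var i)
  have hbase := polySpace_bisectState
    (polySpace_answer ((PolySpacePred.eq hu hv).or hE')) c0 c0 c0 hs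
  exact .ite (.eq hm c0)
    (.ite (.eq hl c0) hbase
      (polySpace_bisectState c0 hu c0 (hl.sub c1) (polySpace_pushFrame hB hs hu hv c0 c0)))
    (.ite (.eq hl hD) hz (.ite (.eq hm c2)
      (.ite (.eq hh c0)
        (polySpace_bisectState c0 hx hv' hl (polySpace_pushFrame hB hs4 hu' hv' hx c1))
        (polySpace_bisectState c2 c0 c0 (hl.add c1) hs4))
      (.ite (.lt hx1 hW)
        (polySpace_bisectState c0 hu' hx1 hl (polySpace_pushFrame hB hs4 hu' hv' hx1 c0))
        (polySpace_bisectState c1 c0 c0 (hl.add c1) hs4))))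

section Correctness

variable {E : ℕ → ℕ → Prop} {W D : ℕ}

theorem mul_add_mod_div {B a b : ℕ} (hb : b < B) : (a * B + b) % B = b ∧ (a * B + b) / B = a := by
  have hB : 0 < B := by omega
  exact ⟨by rw [mul_comm, Nat.mul_add_mod, Nat.mod_eq_of_lt hb], by
    rw [add_comm, Nat.add_mul_div_right _ _ hB, Nat.div_eq_of_lt hb, zero_add]⟩

theorem bisectStep_call_zero (u v s : ℕ) :
    bisectStep E W D (bisectState 0 u v 0 s) =
      bisectState (answer (MidPath E W 0 u v)) 0 0 0 s := by
  simp [bisectStep, bisectState, MidPath]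

theorem bisectStep_call_succ (u v l s : ℕ) :
    bisectStep E W D (bisectState 0 u v (l + 1) s) =
      bisectState 0 u 0 l (pushFrame (W + 2) s u v 0 0) := by
  simp [bisectStep, bisectState]

theorem bisectStep_top {m : ℕ} (hm : m ≠ 0) (u v s : ℕ) :
    bisectStep E W D (bisectState m u v D s) = bisectState m u v D s := by
  simp [bisectStep, bisectState, hm]

/-- A frame on top of the stack can be taken apart again. -/
theorem pushFrame_decode {B s u v x h : ℕ} (hu : u < B) (hv : v < B) (hx : x < B) (hh : h < B) :
    pushFrame B s u v x h % B = h ∧ pushFrame B s u v x h / B % B = x ∧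
      pushFrame B s u v x h / B / B % B = v ∧ pushFrame B s u v x h / B / B / B % B = u ∧
      pushFrame B s u v x h / B / B / B / B = s := by
  simp only [pushFrame, (mul_add_mod_div hu).1, (mul_add_mod_div hu).2, (mul_add_mod_div hv).1,
    (mul_add_mod_div hv).2, (mul_add_mod_div hx).1, (mul_add_mod_div hx).2,
    (mul_add_mod_div hh).1, (mul_add_mod_div hh).2, and_self]

theorem bisectStep_return {m l u v x h s : ℕ} (hm : m ≠ 0) (hl : l ≠ D) (hu : u < W) (hv : v < W)
    (hx : x < W) (hh : h < 2) :
    bisectStep E W D (bisectState m 0 0 l (pushFrame (W + 2) s u v x h)) =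
      if m = 2 then
        if h = 0 then bisectState 0 x v l (pushFrame (W + 2) s u v x 1)
        else bisectState 2 0 0 (l + 1) s
      else if x + 1 < W then bisectState 0 u (x + 1) l (pushFrame (W + 2) s u v (x + 1) 0)
      else bisectState 1 0 0 (l + 1) s := by
  obtain ⟨h₁, h₂, h₃, h₄, h₅⟩ := pushFrame_decode (B := W + 2) (s := s) (u := u) (v := v)
    (x := x) (h := h) (by omega) (by omega) (by omega) (by omega)
  simp only [bisectStep]
  simp only [bisectState, Nat.unpair_pair, hm, hl, if_false, h₁, h₂, h₃, h₄, h₅]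

/-- `b` is reached from `a` by at most `n` steps of the bisection machine. -/
def BisectSteps (E : ℕ → ℕ → Prop) (W D n a b : ℕ) : Prop :=
  ∃ t ≤ n, (bisectStep E W D)^[t] a = b

theorem BisectSteps.trans {m n a b c : ℕ} (h₁ : BisectSteps E W D m a b)
    (h₂ : BisectSteps E W D n b c) : BisectSteps E W D (m + n) a c := by
  obtain ⟨t₁, ht₁, rfl⟩ := h₁
  obtain ⟨t₂, ht₂, rfl⟩ := h₂
  exact ⟨t₂ + t₁, by omega, iterate_add_apply ..⟩

theorem BisectSteps.single {a b : ℕ} (h : bisectStep E W D a = b) : BisectSteps E W D 1 a b :=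
  ⟨1, le_rfl, h⟩

theorem BisectSteps.mono {m n a b : ℕ} (h : BisectSteps E W D m a b) (hmn : m ≤ n) :
    BisectSteps E W D n a b := by
  obtain ⟨t, ht, h⟩ := h
  exact ⟨t, ht.trans hmn, h⟩

/-- The machine tries the midpoints from `x` on, provided that it works correctly on the level
below. -/
theorem bisectSteps_scan {d T u v s : ℕ} (hd : d < D) (hu : u < W) (hv : v < W)
    (ih : ∀ u v s, u < W → v < W → BisectSteps E W D T (bisectState 0 u v d s)
      (bisectState (answer (MidPath E W d u v)) 0 0 d s)) (k x : ℕ) (hk : x + (k + 1) = W) :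
    BisectSteps E W D ((k + 1) * (2 * T + 2))
      (bisectState 0 u x d (pushFrame (W + 2) s u v x 0))
      (bisectState (answer (∃ y < W, x ≤ y ∧ MidPath E W d u y ∧ MidPath E W d y v))
        0 0 (d + 1) s) := by
  induction k generalizing x with
  | zero =>
    have hx : x < W := by omega
    have hiff : (∃ y < W, x ≤ y ∧ MidPath E W d u y ∧ MidPath E W d y v) ↔
        MidPath E W d u x ∧ MidPath E W d x v := by
      refine ⟨fun ⟨y, hy, hxy, h⟩ => ?_, fun h => ⟨x, hx, le_rfl, h⟩⟩
      obtain rfl : y = x := by omega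
      exact h
    rw [hiff]
    have h₁ := ih u x (pushFrame (W + 2) s u v x 0) hu hx
    by_cases hp : MidPath E W d u x
    · rw [answer_true hp] at h₁
      have h₂ := ih x v (pushFrame (W + 2) s u v x 1) hx hv
      have h₃ := h₁.trans ((BisectSteps.single (bisectStep_return two_ne_zero hd.ne hu hv hx
        two_pos)).trans (by simpa using h₂))
      by_cases hq : MidPath E W d x v
      · rw [answer_true hq] at h₃
        rw [answer_true ⟨hp, hq⟩]
        exact (h₃.trans (.single (by
          rw [bisectStep_return two_ne_zero hd.ne hu hv hx one_lt_two]; simp))).mono (by omega)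
      · rw [answer_false hq] at h₃
        rw [answer_false fun h => hq h.2]
        exact (h₃.trans (.single (by
          rw [bisectStep_return one_ne_zero hd.ne hu hv hx one_lt_two]
          simp [show ¬ x + 1 < W by omega]))).mono (by omega)
    · rw [answer_false hp] at h₁
      rw [answer_false fun h => hp h.1]
      exact (h₁.trans (.single (by
        rw [bisectStep_return one_ne_zero hd.ne hu hv hx two_pos]
        simp [show ¬ x + 1 < W by omega]))).mono (by omega)
  | succ k ihk =>
    have hx : x < W := by omega
    have hx1 : x + 1 < W := by omega
    have hnext := ihk (x + 1) (by omega)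
    have hmul : (k + 1 + 1) * (2 * T + 2) = (k + 1) * (2 * T + 2) + (2 * T + 2) := by ring
    have hiff : (∃ y < W, x ≤ y ∧ MidPath E W d u y ∧ MidPath E W d y v) ↔
        (MidPath E W d u x ∧ MidPath E W d x v) ∨
          ∃ y < W, x + 1 ≤ y ∧ MidPath E W d u y ∧ MidPath E W d y v := by
      constructor
      · rintro ⟨y, hy, hxy, h⟩
        rcases hxy.eq_or_lt with rfl | hlt
        exacts [.inl h, .inr ⟨y, hy, hlt, h⟩]
      · rintro (h | ⟨y, hy, hxy, h⟩)
        exacts [⟨x, hx, le_rfl, h⟩, ⟨y, hy, by omega, h⟩]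
    have h₁ := ih u x (pushFrame (W + 2) s u v x 0) hu hx
    by_cases hp : MidPath E W d u x
    · rw [answer_true hp] at h₁
      have h₂ := ih x v (pushFrame (W + 2) s u v x 1) hx hv
      have h₃ := h₁.trans ((BisectSteps.single (bisectStep_return two_ne_zero hd.ne hu hv hx
        two_pos)).trans (by simpa using h₂))
      by_cases hq : MidPath E W d x v
      · rw [answer_true hq] at h₃
        rw [answer_true (hiff.2 (.inl ⟨hp, hq⟩))]
        exact (h₃.trans (.single (by
          rw [bisectStep_return two_ne_zero hd.ne hu hv hx one_lt_two]; simp))).mono (by omega)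
      · rw [answer_false hq] at h₃
        simp only [hiff, hq, and_false, false_or]
        exact (h₃.trans ((BisectSteps.single (by
          rw [bisectStep_return one_ne_zero hd.ne hu hv hx one_lt_two]
          simp [hx1])).trans hnext)).mono (by omega)
    · rw [answer_false hp] at h₁
      simp only [hiff, hp, false_and, false_or]
      exact (h₁.trans ((BisectSteps.single (by
        rw [bisectStep_return one_ne_zero hd.ne hu hv hx two_pos]
        simp [hx1])).trans hnext)).mono (by omega)

/-- The bisection machine evaluates `MidPath` correctly, with a time bound that is exponential in
the level. -/
theorem bisectSteps_call {d u v s : ℕ} (hd : d ≤ D) (hu : u < W) (hv : v < W) :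
    BisectSteps E W D ((4 * W + 1) ^ d) (bisectState 0 u v d s)
      (bisectState (answer (MidPath E W d u v)) 0 0 d s) := by
  induction d generalizing u v s with
  | zero => exact .single (bisectStep_call_zero u v s)
  | succ d ih =>
    have h := bisectSteps_scan (s := s) (by omega) hu hv
      (fun u v s hu hv => ih (by omega) hu hv) (W - 1) 0 (by omega)
    simp only [Nat.zero_le, true_and] at h
    refine ((BisectSteps.single (bisectStep_call_succ u v d s)).trans h).mono ?_
    have h1 : 1 ≤ (4 * W + 1) ^ d := Nat.one_le_pow _ _ (by omega)
    rw [show W - 1 + 1 = W by omega, pow_succ]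
    nlinarith

theorem bisect_correct {u v N : ℕ} (hu : u < W) (hv : v < W) (hN : (4 * W + 1) ^ D ≤ N) :
    ((bisectStep E W D)^[N] (bisectState 0 u v D 0)).unpair.1 = 2 ↔ MidPath E W D u v := by
  obtain ⟨t, ht, h⟩ := bisectSteps_call (E := E) (s := 0) le_rfl hu hv
  obtain ⟨r, rfl⟩ := Nat.exists_eq_add_of_le' (ht.trans hN)
  have hne : answer (MidPath E W D u v) ≠ 0 := by unfold answer; split_ifs <;> simp
  rw [iterate_add_apply, h, iterate_fixed (bisectStep_top hne 0 0 0)]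
  simp only [bisectState, Nat.unpair_pair]
  unfold answer
  split_ifs with hp <;> simp [hp]

/-- All components of a state of the bisection machine are small. -/
def BisectBounded (W D z : ℕ) : Prop :=
  ∃ m u v l s, z = bisectState m u v l s ∧ m ≤ 2 ∧ u < W + 2 ∧ v < W + 2 ∧ l ≤ D ∧
    s < ((W + 2) ^ 4) ^ (D - l)

theorem pushFrame_lt {B s u v x h k : ℕ} (hu : u < B) (hv : v < B) (hx : x < B) (hh : h < B)
    (hs : s < (B ^ 4) ^ k) : pushFrame B s u v x h < (B ^ 4) ^ (k + 1) := by
  have key : ∀ {a b c : ℕ}, a < c → b < B → a * B + b < c * B := fun {a b c} ha hb => by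
    nlinarith [Nat.mul_le_mul_right B (Nat.succ_le_of_lt ha)]
  have := key (key (key (key hs hu) hv) hx) hh
  calc pushFrame B s u v x h < (B ^ 4) ^ k * B * B * B * B := this
    _ = _ := by ring

theorem bisectBounded_step {z : ℕ} (h : BisectBounded W D z) :
    BisectBounded W D (bisectStep E W D z) := by
  obtain ⟨m, u, v, l, s, rfl, hm, hu, hv, hl, hs⟩ := h
  have h0 : 0 < W + 2 := by omega
  have hx := Nat.mod_lt (s / (W + 2)) h0
  have hv' := Nat.mod_lt (s / (W + 2) / (W + 2)) h0
  have hu' := Nat.mod_lt (s / (W + 2) / (W + 2) / (W + 2)) h0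
  have hpop : l ≠ D →
      s / (W + 2) / (W + 2) / (W + 2) / (W + 2) < ((W + 2) ^ 4) ^ (D - (l + 1)) := by
    intro hlD
    rw [Nat.div_div_eq_div_mul, Nat.div_div_eq_div_mul, Nat.div_div_eq_div_mul,
      Nat.div_lt_iff_lt_mul (by positivity)]
    calc s < ((W + 2) ^ 4) ^ (D - (l + 1) + 1) := by
          rwa [show D - (l + 1) + 1 = D - l by omega]
      _ = _ := by ring
  have hrepl : l ≠ D → ∀ {u v x h : ℕ}, u < W + 2 → v < W + 2 → x < W + 2 → h < W + 2 →
      pushFrame (W + 2) (s / (W + 2) / (W + 2) / (W + 2) / (W + 2)) u v x h <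
        ((W + 2) ^ 4) ^ (D - l) := by
    intro hlD u v x h hu hv hx hh
    rw [show D - l = D - (l + 1) + 1 by omega]
    exact pushFrame_lt hu hv hx hh (hpop hlD)
  simp only [bisectStep]
  simp only [bisectState, Nat.unpair_pair]
  simp only [← bisectState.eq_1]
  split_ifs with h1 h2 h3 h4 h5 h6
  · refine ⟨_, _, _, _, _, rfl, ?_, h0, h0, Nat.zero_le _, ?_⟩
    · unfold answer; split_ifs <;> omega
    · rwa [h2] at hs
  · refine ⟨_, _, _, _, _, rfl, by omega, hu, h0, by omega, ?_⟩
    rw [show D - (l - 1) = D - l + 1 by omega]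
    exact pushFrame_lt hu hv h0 h0 hs
  · exact ⟨_, _, _, _, _, rfl, hm, hu, hv, hl, hs⟩
  · exact ⟨_, _, _, _, _, rfl, by omega, hx, hv', hl, hrepl h3 hu' hv' hx (by omega)⟩
  · exact ⟨_, _, _, _, _, rfl, by omega, h0, h0, by omega, hpop h3⟩
  · exact ⟨_, _, _, _, _, rfl, by omega, hu', by omega, hl, hrepl h3 hu' hv' (by omega) h0⟩
  · exact ⟨_, _, _, _, _, rfl, by omega, h0, h0, by omega, hpop h3⟩

theorem pair_le_pair {a b c d : ℕ} (h₁ : a ≤ c) (h₂ : b ≤ d) : Nat.pair a b ≤ Nat.pair c d := by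
  rcases h₁.eq_or_lt with rfl | h₁
  · rcases h₂.eq_or_lt with rfl | h₂
    exacts [le_rfl, (Nat.pair_lt_pair_right _ h₂).le]
  · rcases h₂.eq_or_lt with rfl | h₂
    exacts [(Nat.pair_lt_pair_left _ h₁).le,
      ((Nat.pair_lt_pair_left _ h₁).trans (Nat.pair_lt_pair_right _ h₂)).le]

theorem BisectBounded.le {z : ℕ} (h : BisectBounded W D z) :
    z ≤ bisectState 2 (W + 2) (W + 2) D (((W + 2) ^ 4) ^ D) := by
  obtain ⟨m, u, v, l, s, rfl, hm, hu, hv, hl, hs⟩ := h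
  exact pair_le_pair hm (pair_le_pair hu.le (pair_le_pair hv.le (pair_le_pair hl
    (hs.le.trans (Nat.pow_le_pow_right (by positivity) (Nat.sub_le _ _))))))

end Correctness

/-- Savitch's theorem: reachability in a graph on `{0, …, W - 1}` whose edges are decided in
polynomial space can be decided in polynomial space, where `W` may be exponentially large. -/
theorem PolySpacePred.reachable {n : ℕ} {E : (Fin n → ℕ) → ℕ → ℕ → Prop}
    {W f g : (Fin n → ℕ) → ℕ}
    (hE : PolySpacePred fun v : Fin (n + 2) → ℕ => E (fun i => v i.succ.succ) (v 1) (v 0))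
    (hW : PolySpace W) (hf : PolySpace f) (hg : PolySpace g) :
    PolySpacePred fun a => f a < W a ∧ g a < W a ∧
      Relation.ReflTransGen (fun x y => E a x y ∧ y < W a) (f a) (g a) := by
  let D : (Fin n → ℕ) → ℕ := fun a => (num (W a)).length + 1
  have hD : PolySpace D := hW.length_num.add (.const 1)
  let z₀ : (Fin n → ℕ) → ℕ := fun a => bisectState 0 (min (f a) (W a)) (min (g a) (W a)) (D a) 0
  have hz₀ : PolySpace z₀ :=
    polySpace_bisectState (.const 0) (hf.min hW) (hg.min hW) hD (.const 0)
  let N : (Fin n → ℕ) → ℕ := fun a => (4 * W a + 1) ^ D a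
  have hN : PolySpace N := by
    have h4 := ((PolySpace.const 4).mul hW).add (.const 1)
    simpa only [N, D, pow_succ] using (h4.pow_length hW).mul h4
  let H : (Fin n → ℕ) → ℕ :=
    fun a => bisectState 2 (W a + 2) (W a + 2) (D a) (((W a + 2) ^ 4) ^ D a)
  have hH : PolySpace H := by
    have h2 := hW.add (.const 2)
    have h4 : PolySpace fun a => (W a + 2) ^ 4 := by
      simpa only [pow_succ, pow_zero, one_mul] using ((h2.mul h2).mul h2).mul h2
    refine polySpace_bisectState (.const 2) h2 h2 hD ?_
    simpa only [D, pow_succ (_ ^ 4)] using (h4.pow_length hW).mul h4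
  have hiter : ∀ a k, Nat.rec (z₀ a) (fun _ r => bisectStep (E a) (W a) (D a) r) k =
      (bisectStep (E a) (W a) (D a))^[k] (z₀ a) := fun a k => by
    induction k with
    | zero => rfl
    | succ k ih => rw [iterate_succ_apply', ← ih]
  have hbd : ∀ a k, BisectBounded (W a) (D a) ((bisectStep (E a) (W a) (D a))^[k] (z₀ a)) := by
    intro a k
    induction k with
    | zero => exact ⟨_, _, _, _, _, rfl, by omega, by omega, by omega, le_rfl, by simp⟩
    | succ k ih => rw [iterate_succ_apply']; exact bisectBounded_step ih
  have hrun := PolySpace.limitedRec (g := fun a _ r => bisectStep (E a) (W a) (D a) r) hz₀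
    (polySpace_bisectStep (E := fun v => E fun i => v i.succ.succ)
      (hE.rename fun i : Fin (n + 2) =>
        i.cases 0 fun i => i.cases 1 fun i => i.succ.succ.succ.succ)
      (hW.rename fun i => i.succ.succ) (hD.rename fun i => i.succ.succ) (.var 0)) hN hH
    (fun a y _ => by rw [hiter]; exact (hbd a y).le)
  refine ((PolySpacePred.lt hf hW).and ((PolySpacePred.lt hg hW).and
    (.eq hrun.unpair_fst (.const 2)))).congr fun a => ?_
  refine and_congr_right fun hfa => and_congr_right fun hga => ?_
  rw [hiter, ← midPath_iff_reflTransGen hfa hga (d := D a), ← bisect_correct hfa hga le_rfl]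
  · simp only [z₀, min_eq_left hfa.le, min_eq_left hga.le, N]
  · have := Nat.lt_pow_succ_log_self one_lt_two (W a + 1)
    rw [← length_num] at this
    exact (Nat.le_succ _).trans this.le

/-! ### Recursion with a cap -/

/-- Capping every value of an inflationary recursion has the same effect as capping its result. -/
theorem rec_min_eq {g : ℕ → ℕ → ℕ} (hg : ∀ y r, r ≤ g y r) (x C k : ℕ) :
    Nat.rec (min x C) (fun y r => min (g y r) C) k = min (Nat.rec x (fun y r => g y r) k) C := by
  induction k with
  | zero => rfl
  | succ k ih =>
    change min (g k (Nat.rec (min x C) (fun y r => min (g y r) C) k)) C = _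
    rw [ih]
    change _ = min (g k (Nat.rec x (fun y r => g y r) k)) C
    rcases le_total (Nat.rec x (fun y r => g y r) k : ℕ) C with h | h
    · rw [min_eq_left h]
    · rw [min_eq_right h, min_eq_right (hg k C), min_eq_right (h.trans (hg k _))]

theorem PolySpace.cappedRec {n : ℕ} {f m C : (Fin n → ℕ) → ℕ} {g : (Fin n → ℕ) → ℕ → ℕ → ℕ}
    (hinf : ∀ a y r, r ≤ g a y r) (hf : PolySpace f)
    (hg : PolySpace fun v : Fin (n + 2) → ℕ =>
      Min.min (g (fun i => v i.succ.succ) (v 1) (v 0)) (C fun i => v i.succ.succ))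
    (hm : PolySpace m) (hC : PolySpace C) :
    PolySpace fun a => Min.min (Nat.rec (f a) (fun y r => g a y r) (m a)) (C a) := by
  have := limitedRec (f := fun a => Min.min (f a) (C a)) (g := fun a y r => Min.min (g a y r) (C a))
    (hf.min hC) hg hm hC (fun a y _ => by rw [rec_min_eq (hinf a)]; exact min_le_right _ _)
  convert this using 2 with a
  exact (rec_min_eq (hinf a) _ _ _).symm

/-! ### The intersection problem as a bounded formula -/

/-!
A sequence of natural numbers is given by a function `e : ℕ → ℕ` and its length. In the encoding
of an input, the numbers `e o, e (o + 1), …` describe a recognizer, for the offsets `o` of the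
blocks.
-/

/-- The digit number `j` of `L` in base `B`. -/
def entry (B L j : ℕ) : ℕ := L / B ^ j % B

/-- The product of the elements `x` and `y`, by the multiplication table of the block at `o`. -/
def tab (e : ℕ → ℕ) (o x y : ℕ) : ℕ := e (o + 1 + (x * e o + y))

/-- The image of the letter `c` in the block at `o`. -/
def gen (e : ℕ → ℕ) (o c : ℕ) : ℕ := e (o + 1 + e o * e o + c)

/-- The entry for `x` in the characteristic vector of the block at `o`. -/
def chr (e : ℕ → ℕ) (o x : ℕ) : ℕ := e (o + 1 + e o * e o + e 0 + x)

/-- The offset of the block that follows the block at `o`. -/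
def nextBlock (e : ℕ → ℕ) (o : ℕ) : ℕ := o + (1 + e o * e o + e 0 + e o)

/-- The offset of the block number `i`. -/
def offset (e : ℕ → ℕ) (i : ℕ) : ℕ := Nat.rec 1 (fun _ o => nextBlock e o) i

/-- The element `x` is neutral in the block at `o`. -/
def IsNeutral (e : ℕ → ℕ) (o x : ℕ) : Prop :=
  x < e o ∧ ∀ y < e o, tab e o x y = y ∧ tab e o y x = y

/-- The block at `o` describes a recognizer. -/
def ValidBlock (e : ℕ → ℕ) (o : ℕ) : Prop :=
  (∀ x < e o, ∀ y < e o, tab e o x y < e o) ∧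
  (∀ x < e o, ∀ y < e o, ∀ z < e o, tab e o (tab e o x y) z = tab e o x (tab e o y z)) ∧
  (∃ x < e o, IsNeutral e o x) ∧ (∀ c < e 0, gen e o c < e o) ∧
  ∀ x < e o, chr e o x = 0 ∨ chr e o x = 1

/-- The offset of the block number `i` in the sequence of the base `B` digits of `L`, capped. -/
def cappedOffset (B L C i : ℕ) : ℕ := min (offset (entry B L) i) C

theorem polySpace_entry {n : ℕ} {B L j : (Fin n → ℕ) → ℕ} (hB : PolySpace B) (hL : PolySpace L)
    (hj : PolySpace j) : PolySpace fun a => entry (B a) (L a) (j a) :=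
  (hL.div_pow hB hj).mod hB

theorem polySpace_cappedOffset {n : ℕ} {B L C i : (Fin n → ℕ) → ℕ} (hB : PolySpace B)
    (hL : PolySpace L) (hC : PolySpace C) (hi : PolySpace i) :
    PolySpace fun a => cappedOffset (B a) (L a) (C a) (i a) := by
  refine PolySpace.cappedRec (g := fun a _ o => nextBlock (entry (B a) (L a)) o)
    (fun a y r => Nat.le_add_right _ _) (.const 1) ?_ hi hC
  have hB' := hB.rename fun i => i.succ.succ
  have hL' := hL.rename fun i => i.succ.succ
  have hn := polySpace_entry hB' hL' (.var 0)
  exact ((PolySpace.var 0).add ((((PolySpace.const 1).add (hn.mul hn)).add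
    (polySpace_entry hB' hL' (.const 0))).add hn)).min (hC.rename fun i => i.succ.succ)

/-- Membership of explicitly given functions and predicates in the class, by the structure of the
defining expression. The hypothesis is found by the closure properties and assumptions. -/
theorem polySpace_of_structure {p : Prop} (h : p := by
    repeat' first
      | assumption
      | exact PolySpace.const _
      | exact PolySpace.var _
      | apply polySpace_entry
      | apply polySpace_cappedOffset
      | apply PolySpacePred.exists_lt
      | apply PolySpacePred.forall_lt
      | apply PolySpacePred.and
      | apply PolySpacePred.or
      | apply PolySpacePred.lt
      | apply PolySpacePred.le
      | apply PolySpacePred.eq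
      | apply PolySpace.add
      | apply PolySpace.mul
      | apply PolySpace.div_pow
      | apply PolySpace.mod
      | apply PolySpace.ite) : p :=
  h

/-- From the tuple `u` of elements, one for each of the first `k` blocks, a letter leads to the
tuple `v`. Tuples are numbers in base `B`. -/
def TupleStep (e o : ℕ → ℕ) (B k u v : ℕ) : Prop :=
  ∃ c < e 0, ∀ i < k, entry B v i = tab e (o i) (entry B u i) (gen e (o i) c)

/-- From the tuple of neutral elements a tuple of accepted elements can be reached. -/
def TupleAccepts (e o : ℕ → ℕ) (B k V : ℕ) : Prop :=
  ∃ u < V, ∃ v < V, ((∀ i < k, IsNeutral e (o i) (entry B u i)) ∧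
    ∀ i < k, chr e (o i) (entry B v i) = 1) ∧ (u < V ∧ v < V ∧
      Relation.ReflTransGen (fun x y => TupleStep e o B k x y ∧ y < V) u v)

theorem polySpacePred_validBlock :
    PolySpacePred fun a : Fin 3 → ℕ => ValidBlock (entry (a 0) (a 1)) (a 2) := by
  simp only [ValidBlock, IsNeutral, tab, gen, chr]
  exact polySpace_of_structure

theorem polySpacePred_tupleAccepts : PolySpacePred fun a : Fin 5 → ℕ =>
    TupleAccepts (entry (a 0) (a 1)) (cappedOffset (a 0) (a 1) (a 2)) (a 0) (a 3) (a 4) := by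
  refine .exists_lt (.var 4) (.exists_lt (.var 5) (.and ?_ (.reachable ?_ (.var 6) (.var 1)
    (.var 0))))
  · simp only [IsNeutral, tab, chr]
    exact polySpace_of_structure
  · simp only [TupleStep, tab, gen]
    exact polySpace_of_structure

/-! ### Codes of strings -/

/-- The value of a symbol as a digit in base five. There is no digit zero, so that strings are
determined by their values. -/
def digit : Γ' → ℕ
  | .consₗ => 1
  | .cons => 2
  | .bit0 => 3
  | .bit1 => 4

/-- The value of a string in base five, most significant digit first. -/
def stringCode (w : List Γ') : ℕ := w.foldl (fun r x => 5 * r + digit x) 0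

/-- The code of a string with code `r` after the binary representation of `x` is appended. -/
def appendBits (x r : ℕ) : ℕ :=
  Nat.rec r (fun i r => if x / 2 ^ i = 0 then r else 5 * r + (3 + x / 2 ^ i % 2)) x

/-- The code of the string that represents the list of the numbers `e 0, …, e (n - 1)`. -/
def listCode (e : ℕ → ℕ) (n : ℕ) : ℕ := Nat.rec 0 (fun j r => 5 * appendBits (e j) r + 2) n

theorem le_appendBits (x r : ℕ) : r ≤ appendBits x r := by
  unfold appendBits
  generalize hk : x = k
  have : ∀ k, r ≤ Nat.rec r
      (fun i r => if x / 2 ^ i = 0 then r else 5 * r + (3 + x / 2 ^ i % 2)) k := by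
    intro k
    induction k with
    | zero => exact le_rfl
    | succ k ih => dsimp only; split_ifs <;> omega
  simpa [hk] using this k

theorem polySpace_min_appendBits {n : ℕ} {x r C : (Fin n → ℕ) → ℕ} (hx : PolySpace x)
    (hr : PolySpace r) (hC : PolySpace C) :
    PolySpace fun a => min (appendBits (x a) (r a)) (C a) := by
  refine PolySpace.cappedRec
    (g := fun a i r => if x a / 2 ^ i = 0 then r else 5 * r + (3 + x a / 2 ^ i % 2))
    (fun a y r => by split_ifs <;> omega) hr ?_ hx hC
  have hx' := hx.rename fun i => i.succ.succ
  refine PolySpace.min ?_ (hC.rename fun i => i.succ.succ)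
  exact polySpace_of_structure

theorem polySpace_min_listCode {n : ℕ} {B L m C : (Fin n → ℕ) → ℕ} (hB : PolySpace B)
    (hL : PolySpace L) (hm : PolySpace m) (hC : PolySpace C) :
    PolySpace fun a => min (listCode (entry (B a) (L a)) (m a)) (C a) := by
  refine PolySpace.cappedRec
    (g := fun a j r => 5 * appendBits (entry (B a) (L a) j) r + 2)
    (fun a y r => by have := le_appendBits (entry (B a) (L a) y) r; omega)
    (.const 0) ?_ hm hC
  have hC' := hC.rename fun i => i.succ.succ
  have h := polySpace_min_appendBits (polySpace_entry (hB.rename fun i => i.succ.succ)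
    (hL.rename fun i => i.succ.succ) (.var 1)) (.var 0) hC'
  convert (((PolySpace.const 5).mul h).add (.const 2)).min hC' using 2 with a
  omega

/-- The number `N` is the code of an instance with answer yes. -/
def AcceptsCode (N : ℕ) : Prop :=
  ∃ L < (N + 1) ^ (num N).length, ∃ n < (num N).length + 1, ∃ k < n,
    (min (listCode (entry (N + 1) L) n) (N + 1) = N ∧ cappedOffset (N + 1) L (n + 1) k = n) ∧
    (∀ i < k, ValidBlock (entry (N + 1) L) (cappedOffset (N + 1) L (n + 1) i)) ∧
    TupleAccepts (entry (N + 1) L) (cappedOffset (N + 1) L (n + 1)) (N + 1) k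
      ((N + 1) ^ (num N).length)

theorem polySpacePred_acceptsCode : PolySpacePred fun a : Fin 1 → ℕ => AcceptsCode (a 0) := by
  have hV : ∀ {n : ℕ} (i : Fin n), PolySpace fun a => (a i + 1) ^ (num (a i)).length :=
    fun i => PolySpace.pow_length ((PolySpace.var i).add (.const 1)) (.var i)
  have hB : ∀ {n : ℕ} (i : Fin n), PolySpace fun a => a i + 1 :=
    fun i => (PolySpace.var i).add (.const 1)
  refine .exists_lt (hV 0) (.exists_lt ((PolySpace.length_num (.var 1)).add (.const 1))
    (.exists_lt (.var 0) (.and (.and ?_ ?_) (.and (.forall_lt (.var 0) ?_) ?_))))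
  · exact .eq (polySpace_min_listCode (hB 3) (.var 2) (.var 1) (hB 3)) (.var 3)
  · exact .eq (polySpace_cappedOffset (hB 3) (.var 2) (hB 1) (.var 0)) (.var 1)
  · exact polySpacePred_validBlock.comp (G := ![fun a => a 4 + 1, fun a => a 3,
      fun a => cappedOffset (a 4 + 1) (a 3) (a 2 + 1) (a 0)]) (by
        simpa [Fin.forall_fin_succ] using
          ⟨hB 4, .var 3, polySpace_cappedOffset (hB 4) (.var 3) (hB 2) (.var 0)⟩)
  · exact polySpacePred_tupleAccepts.comp (G := ![fun a => a 3 + 1, fun a => a 2,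
      fun a => a 1 + 1, fun a => a 0, fun a => (a 3 + 1) ^ (num (a 3)).length]) (by
        simpa [Fin.forall_fin_succ] using ⟨hB 3, .var 2, hB 1, .var 0, hV 3⟩)

/-! ### Reading the input -/

theorem num_eq_nil_iff {n : ℕ} : num n = [] ↔ n = 0 := by
  refine ⟨fun h => ?_, fun h => h ▸ rfl⟩
  rw [← numeralValue_num n, h]; rfl

theorem stringCode_append_singleton (w : List Γ') (x : Γ') :
    stringCode (w ++ [x]) = 5 * stringCode w + digit x := by
  simp [stringCode]

theorem digit_bounds (x : Γ') : 1 ≤ digit x ∧ digit x ≤ 4 := by cases x <;> decide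

theorem pow_le_stringCode (w : List Γ') : 2 ^ w.length ≤ stringCode w + 1 := by
  induction w using List.reverseRecOn with
  | nil => simp [stringCode]
  | append_singleton w x ih =>
    have := digit_bounds x
    rw [stringCode_append_singleton, List.length_append, List.length_singleton, pow_succ]
    omega

theorem stringCode_lt_pow (w : List Γ') : stringCode w < 5 ^ w.length := by
  induction w using List.reverseRecOn with
  | nil => simp [stringCode]
  | append_singleton w x ih =>
    have := digit_bounds x
    rw [stringCode_append_singleton, List.length_append, List.length_singleton, pow_succ]
    omega

theorem length_num_stringCode_le (w : List Γ') : (num (stringCode w)).length ≤ 3 * w.length := by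
  rw [length_num, ← Nat.log_pow one_lt_two (3 * w.length)]
  refine Nat.log_mono_right ((Nat.succ_le_of_lt (stringCode_lt_pow w)).trans ?_)
  rw [pow_mul]
  exact Nat.pow_le_pow_left (by norm_num) _

theorem length_le_length_num_stringCode (w : List Γ') :
    w.length ≤ (num (stringCode w)).length := by
  rw [length_num]
  exact Nat.le_log_of_pow_le one_lt_two (pow_le_stringCode w)

theorem stringCode_injective : Injective stringCode := by
  intro v
  induction v using List.reverseRecOn with
  | nil =>
    intro w h
    have := pow_le_stringCode w
    rw [← h] at this
    have h0 : w.length = 0 := by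
      by_contra hne
      have := Nat.pow_le_pow_right two_pos (Nat.one_le_iff_ne_zero.2 hne)
      simp only [stringCode, List.foldl_nil] at *
      omega
    exact (List.length_eq_zero_iff.1 h0).symm
  | append_singleton v x ih =>
    intro w h
    have hx := digit_bounds x
    induction w using List.reverseRecOn with
    | nil =>
      rw [stringCode_append_singleton] at h
      simp only [stringCode, List.foldl_nil] at h
      omega
    | append_singleton w y _ =>
      rw [stringCode_append_singleton, stringCode_append_singleton] at h
      have hy := digit_bounds y
      have hxy : x = y := by
        have : digit x = digit y := by omega
        cases x <;> cases y <;> simp_all [digit]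
      subst hxy
      rw [ih (a₂ := w) (by omega)]

/-- A property of strings that is decided by a function of the class `PolySpace`, applied to the
codes of the strings, defines a language in `PSPACE`. -/
theorem mem_PSPACE_of_polySpacePred {P : ℕ → Prop}
    (hP : PolySpacePred fun a : Fin 1 → ℕ => P (a 0)) {L : Language Γ'}
    (hL : ∀ w, w ∈ L ↔ P (stringCode w)) : L ∈ PSPACE Γ' := by
  obtain ⟨f, hf, hPf⟩ := hP
  have hstep : ∀ x : Γ', PolySpace fun a : Fin 1 → ℕ => 5 * a 0 + digit x := fun x =>
    ((PolySpace.const 5).mul (.var 0)).add (.const _)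
  -- Stack `0` holds the rest of the input, and stacks `1` and `2` the code of the part read.
  choose c p hc using fun x => (hstep x).computes (fun _ => 1) 2 3 (by simp) (by simp) (by simp)
  obtain ⟨cf, pf, hcf⟩ := hf.computes (fun _ => 1) 2 3 (by simp) (by simp) (by simp)
  let read : Γ' → Cmd := fun x => .seq (c x) (.seq (.copy 2 1 3 4) (.pop 0))
  let body : Cmd :=
    .ite 0 (fun z => z == some .consₗ) (read .consₗ) <|
    .ite 0 (fun z => z == some .cons) (read .cons) <|
    .ite 0 (fun z => z == some .bit0) (read .bit0) (read .bit1)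
  let q : Polynomial ℕ := 3 * .X
  let b : Polynomial ℕ := q + (p .consₗ + p .cons + p .bit0 + p .bit1 + pf).comp q
  refine mem_PSPACE_of_run (.seq (.loop 0 Option.isSome body) cf) 2 b fun w => ?_
  let T : ℕ → Store := fun j =>
    update (update (update (fun _ => []) 0 (w.drop j)) 1 (num (stringCode (w.take j)))) 2
      (num (stringCode (w.take j)))
  have hQ : q.eval w.length = 3 * w.length := by simp [q]
  have hb : b.eval w.length = 3 * w.length + ((p .consₗ).eval (3 * w.length) +
      (p .cons).eval (3 * w.length) + (p .bit0).eval (3 * w.length) +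
      (p .bit1).eval (3 * w.length) + pf.eval (3 * w.length)) := by
    simp [b, hQ]
  have hpx : ∀ x, (p x).eval (3 * w.length) ≤ b.eval w.length := by
    intro x; cases x <;> omega
  have hlen : ∀ j, (num (stringCode (w.take j))).length ≤ 3 * w.length := fun j =>
    (length_num_stringCode_le _).trans (by simp)
  have hT : ∀ j, Fits (3 * w.length) (T j) := fun j =>
    ((Fits.update (fun _ => by simp) 0 (by simp; omega)).update 1 (hlen j)).update 2 (hlen j)
  have h0 : update (fun _ => []) 0 w = T 0 := by
    funext i
    simp only [T, stringCode, List.take_zero, List.foldl_nil, List.drop_zero, num_zero]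
    grind [Function.update_apply]
  have hread : ∀ x j, w.drop j = x :: w.drop (j + 1) → w.take (j + 1) = w.take j ++ [x] →
      Run (b.eval w.length) (read x) (T j) (T (j + 1)) := by
    intro x j hd ht
    have r1 := hc x _ (T j) (fun _ => stringCode (w.take j)) (hT j) (fun _ => by simp [T])
      (fun i hi => by simp [T, show i ≠ 0 by omega, show i ≠ 1 by omega, show i ≠ 2 by omega])
    dsimp only at r1
    rw [← stringCode_append_singleton, ← ht] at r1
    have r2 := run_copy (k := 2) (o := 1) (t := 3) (t' := 4) (by simp) (by simp) (by simp)
      (by simp) (by simp) (by simp) r1.fits_right (update_self ..) (by simp [T]) (by simp [T])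
    have r3 := Run.pop 0 r2.fits_right
    refine Run.congr ((r1.mono (hpx x)).seq ((r2.mono (hpx x)).seq (r3.mono (hpx x)))) ?_
    funext i
    simp only [T, update_apply, hd]
    grind
  have hbody : ∀ j < w.length, Run (b.eval w.length) body (T j) (T (j + 1)) := by
    intro j hj
    have hd := List.drop_eq_getElem_cons hj
    have hr := hread w[j] j hd (by simp)
    have hh : (T j 0).head? = some w[j] := by
      rw [show T j 0 = w.drop j by simp [T], hd, List.head?_cons]
    generalize w[j] = x at hr hh
    cases x
    · exact .ite_true (by simp [hh]) hr
    · exact .ite_false (by simp [hh]) (.ite_true (by simp [hh]) hr)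
    · exact .ite_false (by simp [hh]) (.ite_false (by simp [hh]) (.ite_true (by simp [hh]) hr))
    · exact .ite_false (by simp [hh]) (.ite_false (by simp [hh]) (.ite_false (by simp [hh]) hr))
  have r1 := Run.loop_of_seq (k := 0) (p := Option.isSome) (n := w.length) T
    ((hT w.length).mono (by omega)) (by simp [T])
    (fun j hj => by simp [T, hj]) hbody
  have r2 := hcf _ (T w.length) (fun _ => stringCode w) (hT w.length) (fun _ => by simp [T])
    (fun i hi => by simp [T, show i ≠ 1 by omega, show i ≠ 2 by omega])
  refine ⟨_, h0 ▸ r1.seq (r2.mono (by omega)), ?_⟩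
  rw [update_self, ne_eq, num_eq_nil_iff, hL]
  exact (hPf fun _ => stringCode w).symm

/-! ### Codes of lists -/

theorem trNat_of_ne_zero {x : ℕ} (hx : x ≠ 0) :
    trNat x = (if x % 2 = 0 then .bit0 else .bit1) :: trNat (x / 2) := by
  have hne : ∀ y : ℕ, y ≠ 0 → ∃ p : PosNum, (y : Num) = .pos p := by
    intro y hy
    cases h : (y : Num) with
    | zero => exact absurd (by simpa using congrArg (fun z : Num => (z : ℕ)) h) hy
    | pos p => exact ⟨p, rfl⟩
  obtain ⟨y, rfl | rfl⟩ := x.even_or_odd'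
  · obtain ⟨p, hp⟩ := hne y (by omega)
    rw [if_pos (by omega), show 2 * y / 2 = y by omega, trNat, trNat]
    rw [two_mul, Nat.cast_add, Num.bit0_of_bit0, hp]
    rfl
  · rw [if_neg (by omega), show (2 * y + 1) / 2 = y by omega, trNat, trNat]
    rw [two_mul, Nat.cast_add, Nat.cast_add, Nat.cast_one, Num.bit1_of_bit1]
    cases (y : Num) <;> rfl

theorem lt_two_pow_length_trNat (x : ℕ) : x < 2 ^ (trNat x).length := by
  induction x using Nat.strong_induction_on with
  | _ x ih =>
    rcases eq_or_ne x 0 with rfl | hx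
    · simp
    · have := ih (x / 2) (by omega)
      rw [trNat_of_ne_zero hx, List.length_cons, pow_succ]
      omega

theorem trList_append (l l' : List ℕ) : trList (l ++ l') = trList l ++ trList l' := by
  induction l with
  | nil => rfl
  | cons x l ih => simp [ih]

theorem length_le_length_trList (l : List ℕ) : l.length ≤ (trList l).length := by
  induction l with
  | nil => simp
  | cons x l ih => simp; omega

theorem length_trNat_le {l : List ℕ} {x : ℕ} (hx : x ∈ l) :
    (trNat x).length ≤ (trList l).length := by
  induction l with
  | nil => simp at hx
  | cons y l ih =>
    rcases List.mem_cons.1 hx with rfl | hx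
    · simp
    · have := ih hx; simp; omega

theorem rec_succ_eq (g : ℕ → ℕ → ℕ) (r m : ℕ) :
    (Nat.rec r (fun i r => g i r) (m + 1) : ℕ) =
      Nat.rec (motive := fun _ => ℕ) (g 0 r) (fun i r => g (i + 1) r) m := by
  induction m with
  | zero => rfl
  | succ m ih => exact congrArg (g (m + 1)) ih

theorem appendBits_eq (x r : ℕ) :
    appendBits x r = (trNat x).foldl (fun r y => 5 * r + digit y) r := by
  have key : ∀ m x r, x ≤ m →
      Nat.rec r (fun i r => if x / 2 ^ i = 0 then r else 5 * r + (3 + x / 2 ^ i % 2)) m =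
        (trNat x).foldl (fun r y => 5 * r + digit y) r := by
    intro m
    induction m with
    | zero =>
      intro x r hx
      obtain rfl := Nat.le_zero.1 hx
      simp
    | succ m ih =>
      intro x r hx
      rw [rec_succ_eq fun i r => if x / 2 ^ i = 0 then r else 5 * r + (3 + x / 2 ^ i % 2)]
      simp only [pow_succ', ← Nat.div_div_eq_div_mul]
      rw [ih (x / 2) _ (by omega)]
      rcases eq_or_ne x 0 with rfl | h0
      · simp
      · rw [trNat_of_ne_zero h0, List.foldl_cons]
        congr 1
        rcases Nat.mod_two_eq_zero_or_one x with h | h <;> simp [h0, h, digit]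
  exact key x x r le_rfl

theorem listCode_eq (e : ℕ → ℕ) (n : ℕ) :
    listCode e n = stringCode (trList ((List.range n).map e)) := by
  induction n with
  | zero => rfl
  | succ n ih =>
    change 5 * appendBits (e n) (listCode e n) + 2 = _
    rw [ih, appendBits_eq, List.range_succ, List.map_append, trList_append]
    simp [stringCode, digit]

/-! ### Tuples of elements -/

/-- The element reached from `x` by a word, in the block at `o`. -/
def runWord (e : ℕ → ℕ) (o x : ℕ) (w : List ℕ) : ℕ :=
  w.foldl (fun x c => tab e o x (gen e o c)) x

theorem exists_entry_eq {B k : ℕ} {f : ℕ → ℕ} (hf : ∀ i < k, f i < B) :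
    ∃ u < B ^ k, ∀ i < k, entry B u i = f i := by
  induction k generalizing f with
  | zero => exact ⟨0, by simp, by simp⟩
  | succ k ih =>
    obtain ⟨u, hu, h⟩ := ih (f := fun i => f (i + 1)) fun i hi => hf (i + 1) (by omega)
    have h0 := hf 0 k.succ_pos
    refine ⟨u * B + f 0, ?_, fun i hi => ?_⟩
    · rw [pow_succ]; nlinarith [Nat.mul_le_mul_right B (Nat.succ_le_of_lt hu)]
    · rcases i with _ | i
      · simp [entry, (mul_add_mod_div h0).1]
      · rw [← h i (by omega), entry, pow_succ', ← Nat.div_div_eq_div_mul, (mul_add_mod_div h0).2,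
          entry]

theorem exists_word_of_reflTransGen {e o : ℕ → ℕ} {B k V u v : ℕ}
    (h : Relation.ReflTransGen (fun x y => TupleStep e o B k x y ∧ y < V) u v) :
    ∃ w : List ℕ, (∀ c ∈ w, c < e 0) ∧
      ∀ i < k, entry B v i = runWord e (o i) (entry B u i) w := by
  induction h with
  | refl => exact ⟨[], by simp, fun _ _ => rfl⟩
  | tail _ h ih =>
    obtain ⟨w, hw, ih⟩ := ih
    obtain ⟨⟨c, hc, h⟩, _⟩ := h
    refine ⟨w ++ [c], fun c' hc' => ?_, fun i hi => ?_⟩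
    · rcases List.mem_append.1 hc' with h' | h'
      exacts [hw _ h', (List.mem_singleton.1 h') ▸ hc]
    · rw [h i hi, ih i hi]; simp [runWord]

theorem exists_reflTransGen_of_word {e o : ℕ → ℕ} {B k V u : ℕ} (hV : B ^ k ≤ V)
    (hB : ∀ i < k, e (o i) ≤ B) (hvalid : ∀ i < k, ValidBlock e (o i))
    (hu : ∀ i < k, entry B u i < e (o i)) (huV : u < V) {w : List ℕ} (hw : ∀ c ∈ w, c < e 0) :
    ∃ v < V, Relation.ReflTransGen (fun x y => TupleStep e o B k x y ∧ y < V) u v ∧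
      ∀ i < k, entry B v i = runWord e (o i) (entry B u i) w := by
  induction w generalizing u with
  | nil => exact ⟨u, huV, .refl, fun _ _ => rfl⟩
  | cons c w ih =>
    have hc : c < e 0 := hw c (by simp)
    have hlt : ∀ i < k, tab e (o i) (entry B u i) (gen e (o i) c) < e (o i) := fun i hi =>
      (hvalid i hi).1 _ (hu i hi) _ ((hvalid i hi).2.2.2.1 c hc)
    obtain ⟨u', hu', h'⟩ := exists_entry_eq fun i hi => (hlt i hi).trans_le (hB i hi)
    obtain ⟨v, hv, hr, h⟩ := ih (u := u') (fun i hi => by rw [h' i hi]; exact hlt i hi)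
      (hu'.trans_le hV) fun c hc => hw c (by simp [hc])
    refine ⟨v, hv, .head ⟨⟨c, hc, h'⟩, hu'.trans_le hV⟩ hr, fun i hi => ?_⟩
    rw [h i hi, h' i hi]
    simp [runWord]

theorem tupleAccepts_iff {e o : ℕ → ℕ} {B k V : ℕ} (hV : B ^ k ≤ V)
    (hB : ∀ i < k, e (o i) ≤ B) (hvalid : ∀ i < k, ValidBlock e (o i)) :
    TupleAccepts e o B k V ↔ ∃ w : List ℕ, (∀ c ∈ w, c < e 0) ∧
      ∀ i < k, ∃ x, IsNeutral e (o i) x ∧ chr e (o i) (runWord e (o i) x w) = 1 := by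
  constructor
  · rintro ⟨u, _, v, _, ⟨hu, hv⟩, _, _, h⟩
    obtain ⟨w, hw, h⟩ := exists_word_of_reflTransGen h
    exact ⟨w, hw, fun i hi => ⟨_, hu i hi, h i hi ▸ hv i hi⟩⟩
  · rintro ⟨w, hw, h⟩
    choose! x hx hacc using h
    obtain ⟨u, hu, hux⟩ := exists_entry_eq fun i hi => (hx i hi).1.trans_le (hB i hi)
    obtain ⟨v, hv, hr, h⟩ := exists_reflTransGen_of_word hV hB hvalid
      (fun i hi => by rw [hux i hi]; exact (hx i hi).1) (hu.trans_le hV) hw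
    refine ⟨u, hu.trans_le hV, v, hv, ⟨fun i hi => ?_, fun i hi => ?_⟩, hu.trans_le hV, hv, hr⟩
    · rw [hux i hi]; exact hx i hi
    · rw [h i hi, hux i hi]; exact hacc i hi

/-! ### Descriptions of recognizers -/

/-- The list `l` occurs in the sequence `e` at the position `s`. -/
def OccursAt (e : ℕ → ℕ) (s : ℕ) (l : List ℕ) : Prop :=
  ∀ (j : ℕ) (hj : j < l.length), l[j] = e (s + j)

theorem occursAt_append {e : ℕ → ℕ} {s : ℕ} {l l' : List ℕ} :
    OccursAt e s (l ++ l') ↔ OccursAt e s l ∧ OccursAt e (s + l.length) l' := by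
  constructor
  · intro h
    refine ⟨fun j hj => ?_, fun j hj => ?_⟩
    · rw [← h j (by simp; omega), List.getElem_append_left hj]
    · rw [add_assoc, ← h (l.length + j) (by simp; omega), List.getElem_append_right (by omega)]
      simp
  · rintro ⟨h, h'⟩ j hj
    rcases lt_or_ge j l.length with hl | hl
    · rw [List.getElem_append_left hl, h]
    · rw [List.getElem_append_right hl, h', show s + l.length + (j - l.length) = s + j by omega]

theorem occursAt_map_finRange {e : ℕ → ℕ} {s n : ℕ} {f : Fin n → ℕ} :
    OccursAt e s ((List.finRange n).map f) ↔ ∀ j : Fin n, f j = e (s + j) := by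
  constructor
  · intro h j
    simpa using h j (by simp)
  · intro h j hj
    simpa using h ⟨j, by simpa using hj⟩

theorem occursAt_flatMap_finRange {e : ℕ → ℕ} {k : ℕ} {F : Fin k → List ℕ} {o : ℕ → ℕ}
    (ho : ∀ i : Fin k, o (i + 1) = o i + (F i).length) :
    (OccursAt e (o 0) ((List.finRange k).flatMap F) ↔ ∀ i : Fin k, OccursAt e (o i) (F i)) ∧
      o 0 + ((List.finRange k).flatMap F).length = o k := by
  induction k generalizing o with
  | zero =>
    refine ⟨⟨fun _ i => i.elim0, fun _ j hj => ?_⟩, by simp⟩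
    simp at hj
  | succ k ih =>
    have h0 : o 1 = o 0 + (F 0).length := ho 0
    obtain ⟨h₁, h₂⟩ := ih (F := fun i => F i.succ) (o := fun i => o (i + 1)) fun i => ho i.succ
    simp only [zero_add, h0] at h₁ h₂
    have hl : (List.finRange (k + 1)).flatMap F =
        F 0 ++ (List.finRange k).flatMap fun i => F i.succ := by
      rw [List.finRange_succ, List.flatMap_cons, List.flatMap_map]
    rw [hl, occursAt_append, h₁, Fin.forall_fin_succ, List.length_append, ← add_assoc]
    exact ⟨Iff.rfl, h₂⟩

theorem length_code {A : Type} {a : ℕ} (ltr : Fin a ≃ A) (R : Recognizer A) :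
    (R.code ltr).length = 1 + R.size * R.size + a + R.size := by
  simp [Recognizer.code, List.length_flatMap]
  ring

open Classical in
/-- The entries of a sequence that contains the description of a recognizer. -/
theorem occursAt_code_iff {e : ℕ → ℕ} {o : ℕ} {A : Type} {a : ℕ} {ltr : Fin a ≃ A}
    {R : Recognizer A} : OccursAt e o (R.code ltr) ↔ e o = R.size ∧
      (∀ x y : Fin R.size, (R.enum.symm (R.enum x * R.enum y) : ℕ) =
        e (o + 1 + (x * R.size + y))) ∧
      (∀ c : Fin a, (R.enum.symm (R.hom (FreeMonoid.of (ltr c))) : ℕ) =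
        e (o + 1 + R.size * R.size + c)) ∧
      ∀ x : Fin R.size, (if R.enum x ∈ R.P then 1 else 0) =
        e (o + 1 + R.size * R.size + a + x) := by
  have h₁ : OccursAt e o [R.size] ↔ e o = R.size := by
    refine ⟨fun h => (h 0 (by simp)).symm, fun h j hj => ?_⟩
    obtain rfl : j = 0 := by simpa using hj
    exact h.symm
  have h₂ := (occursAt_flatMap_finRange (e := e) (o := fun i => o + 1 + i * R.size)
    (F := fun x : Fin R.size => (List.finRange R.size).map fun y =>
      (R.enum.symm (R.enum x * R.enum y) : ℕ)) fun i => by simp; ring).1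
  simp only [zero_mul, add_zero, occursAt_map_finRange, add_assoc (o + 1)] at h₂
  have hl : ((List.finRange R.size).flatMap fun x => (List.finRange R.size).map fun y =>
      (R.enum.symm (R.enum x * R.enum y) : ℕ)).length = R.size * R.size := by
    simp [List.length_flatMap]
  rw [Recognizer.code, occursAt_append, occursAt_append, occursAt_append, h₁]
  simp only [List.length_append, List.length_singleton, hl, List.length_map, List.length_finRange]
  rw [h₂, occursAt_map_finRange, occursAt_map_finRange]
  simp only [and_assoc, add_assoc]

section Block

variable {e : ℕ → ℕ} {o a : ℕ} {A : Type} {ltr : Fin a ≃ A} {R : Recognizer A}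

theorem tab_eq (h : OccursAt e o (R.code ltr)) (x y : R.M) :
    tab e o (R.enum.symm x) (R.enum.symm y) = R.enum.symm (x * y) := by
  obtain ⟨h₁, h₂, -⟩ := occursAt_code_iff.1 h
  rw [tab, h₁, ← h₂]
  simp

theorem gen_eq (h : OccursAt e o (R.code ltr)) (c : A) :
    gen e o (ltr.symm c) = R.enum.symm (R.hom (FreeMonoid.of c)) := by
  obtain ⟨h₁, -, h₂, -⟩ := occursAt_code_iff.1 h
  rw [gen, h₁, ← h₂]
  simp

theorem chr_eq_one_iff (h : OccursAt e o (R.code ltr)) (ha : e 0 = a) (x : R.M) :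
    chr e o (R.enum.symm x) = 1 ↔ x ∈ R.P := by
  classical
  obtain ⟨h₁, -, -, h₂⟩ := occursAt_code_iff.1 h
  rw [chr, h₁, ha, ← h₂]
  simp

theorem isNeutral_one (h : OccursAt e o (R.code ltr)) : IsNeutral e o (R.enum.symm 1) := by
  have h₁ := (occursAt_code_iff.1 h).1
  refine ⟨by rw [h₁]; exact Fin.is_lt _, fun y hy => ?_⟩
  have hy' : y = (R.enum.symm (R.enum ⟨y, h₁ ▸ hy⟩) : ℕ) := by simp
  rw [hy', tab_eq h, tab_eq h, one_mul, mul_one]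
  exact ⟨rfl, rfl⟩

theorem eq_of_isNeutral (h : OccursAt e o (R.code ltr)) {x : ℕ} (hx : IsNeutral e o x) :
    x = (R.enum.symm 1 : ℕ) := by
  have h1 := isNeutral_one h
  rw [← (h1.2 x hx.1).1, (hx.2 _ h1.1).2]

theorem validBlock_of_occursAt (h : OccursAt e o (R.code ltr)) (ha : e 0 = a) :
    ValidBlock e o := by
  obtain ⟨h₁, -, h₃, h₄⟩ := occursAt_code_iff.1 h
  have hsymm : ∀ x < e o, ∃ m : R.M, x = (R.enum.symm m : ℕ) := fun x hx =>
    ⟨R.enum ⟨x, h₁ ▸ hx⟩, by simp⟩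
  have hlt : ∀ m : R.M, (R.enum.symm m : ℕ) < e o := fun m => by rw [h₁]; exact Fin.is_lt _
  refine ⟨fun x hx y hy => ?_, fun x hx y hy z hz => ?_, ⟨_, hlt 1, isNeutral_one h⟩,
    fun c hc => ?_, fun x hx => ?_⟩
  · obtain ⟨m, rfl⟩ := hsymm x hx
    obtain ⟨m', rfl⟩ := hsymm y hy
    rw [tab_eq h]
    exact hlt _
  · obtain ⟨m, rfl⟩ := hsymm x hx
    obtain ⟨m', rfl⟩ := hsymm y hy
    obtain ⟨m'', rfl⟩ := hsymm z hz
    rw [tab_eq h, tab_eq h, tab_eq h, tab_eq h, mul_assoc]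
  · have := h₃ ⟨c, ha ▸ hc⟩
    rw [gen, h₁, ← this]
    exact Fin.is_lt _
  · have := h₄ ⟨x, h₁ ▸ hx⟩
    rw [chr, h₁, ha, ← this]
    split_ifs
    exacts [.inr rfl, .inl rfl]

theorem runWord_eq (h : OccursAt e o (R.code ltr)) (w : List A) (m : R.M) :
    runWord e o (R.enum.symm m) (w.map fun c => (ltr.symm c : ℕ)) =
      R.enum.symm (m * R.hom (FreeMonoid.ofList w)) := by
  induction w generalizing m with
  | nil => simp [runWord]
  | cons c w ih =>
    rw [FreeMonoid.ofList_cons, map_mul R.hom, ← mul_assoc, ← ih, ← tab_eq h, ← gen_eq h]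
    rfl

/-- Acceptance of a word in terms of the description of a recognizer. -/
theorem exists_isNeutral_iff (h : OccursAt e o (R.code ltr)) (ha : e 0 = a) (w : List A) :
    (∃ x, IsNeutral e o x ∧ chr e o (runWord e o x (w.map fun c => (ltr.symm c : ℕ))) = 1) ↔
      FreeMonoid.ofList w ∈ R.language := by
  have key : chr e o (runWord e o (R.enum.symm 1) (w.map fun c => (ltr.symm c : ℕ))) = 1 ↔
      FreeMonoid.ofList w ∈ R.language := by
    rw [runWord_eq h, one_mul, chr_eq_one_iff h ha]
    rfl
  constructor
  · rintro ⟨x, hx, hc⟩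
    rw [eq_of_isNeutral h hx] at hc
    exact key.1 hc
  · intro hw
    exact ⟨_, isNeutral_one h, key.2 hw⟩

end Block

/-- Every valid block is the description of a recognizer. -/
theorem ValidBlock.exists_recognizer {e : ℕ → ℕ} {o : ℕ} (h : ValidBlock e o) :
    ∃ R : Recognizer (Fin (e 0)), OccursAt e o (R.code (Equiv.refl _)) := by
  classical
  obtain ⟨hmul, hassoc, ⟨i, hi, hi1⟩, hgen, hchr⟩ := h
  let mon : Monoid (Fin (e o)) :=
    { mul := fun x y => ⟨tab e o x y, hmul x x.2 y y.2⟩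
      one := ⟨i, hi⟩
      mul_assoc := fun x y z => Fin.ext (hassoc x x.2 y y.2 z z.2)
      one_mul := fun x => Fin.ext (hi1.2 x x.2).1
      mul_one := fun x => Fin.ext (hi1.2 x x.2).2 }
  refine ⟨{ M := Fin (e o), size := e o, enum := Equiv.refl _,
            hom := FreeMonoid.lift fun c => ⟨gen e o c, hgen c c.2⟩,
            P := {x | chr e o x = 1} }, occursAt_code_iff.2 ⟨rfl, fun x y => rfl, fun c => ?_,
            fun x => ?_⟩⟩
  · simp only [Equiv.refl_symm, Equiv.refl_apply, FreeMonoid.lift_eval_of]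
    rfl
  · change @ite ℕ (chr e o x = 1) (Classical.propDecidable _) 1 0 = chr e o x
    rcases hchr x x.2 with h | h <;> simp [h]

/-! ### Descriptions of inputs -/

theorem offset_succ (e : ℕ → ℕ) (i : ℕ) : offset e (i + 1) = nextBlock e (offset e i) := rfl

theorem offset_strictMono (e : ℕ → ℕ) : StrictMono (offset e) :=
  strictMono_nat_of_lt_succ fun i => by rw [offset_succ, nextBlock]; omega

theorem succ_le_offset (e : ℕ → ℕ) (i : ℕ) : i + 1 ≤ offset e i := by
  induction i with
  | zero => exact le_rfl
  | succ i ih => exact Nat.succ_le_of_lt (ih.trans_lt (offset_strictMono e i.lt_succ_self))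

theorem occursAt_zero_iff {e : ℕ → ℕ} {l : List ℕ} :
    OccursAt e 0 l ↔ (List.range l.length).map e = l := by
  constructor
  · intro h
    refine List.ext_getElem (by simp) fun j _ hj => ?_
    simp [h j hj]
  · intro h j hj
    have := List.getElem_of_eq h.symm hj
    simpa using this

theorem occursAt_code_input_iff {e : ℕ → ℕ} {I : MonIsectInput} :
    OccursAt e 0 I.code ↔ e 0 = I.numLetters ∧
      OccursAt e 1 ((List.finRange I.k).flatMap fun i => (I.recog i).code I.ltr) := by
  rw [MonIsectInput.code, ← List.singleton_append, occursAt_append]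
  refine and_congr ⟨fun h => (h 0 (by simp)).symm, fun h j hj => ?_⟩ (by simp)
  obtain rfl : j = 0 := by simpa using hj
  exact h.symm

/-- In the description of an input, the recognizer number `i` starts at the offset of the block
number `i`, since the number that is found there is the size of the monoid. -/
theorem occursAt_code_of_input {e : ℕ → ℕ} {I : MonIsectInput} (h : OccursAt e 0 I.code) :
    (∀ i : Fin I.k, OccursAt e (offset e i) ((I.recog i).code I.ltr)) ∧
      offset e I.k = I.code.length := by
  obtain ⟨h0, h⟩ := occursAt_code_input_iff.1 h
  let o : ℕ → ℕ := fun i => Nat.rec 1 (fun i s =>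
    s + if hi : i < I.k then ((I.recog ⟨i, hi⟩).code I.ltr).length else 0) i
  obtain ⟨h₁, h₂⟩ := occursAt_flatMap_finRange (e := e) (o := o)
    (F := fun i => (I.recog i).code I.ltr) fun i => by simp [o]
  have hblock := h₁.1 h
  have ho : ∀ i ≤ I.k, o i = offset e i := by
    intro i hi
    induction i with
    | zero => rfl
    | succ i ih =>
      have hs := (occursAt_code_iff.1 (hblock ⟨i, hi⟩)).1
      change o i + dite _ _ _ = _
      rw [dif_pos (show i < I.k from hi), length_code, offset_succ, nextBlock, ← ih (by omega), h0]
      change e (o i) = _ at hs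
      rw [hs]
  refine ⟨fun i => ho i i.2.le ▸ hblock i, ?_⟩
  rw [← ho _ le_rfl, ← h₂, MonIsectInput.code, List.length_cons, add_comm]
  rfl

/-- The input whose recognizers are described by the first `k` blocks of a sequence. -/
theorem occursAt_code_input_of_blocks {e : ℕ → ℕ} {k : ℕ} {R : Fin k → Recognizer (Fin (e 0))}
    (h : ∀ i : Fin k, OccursAt e (offset e i) ((R i).code (Equiv.refl _))) :
    OccursAt e 0 (MonIsectInput.mk _ _ (Equiv.refl _) k R).code ∧
      (MonIsectInput.mk _ _ (Equiv.refl _) k R).code.length = offset e k := by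
  obtain ⟨h₁, h₂⟩ := occursAt_flatMap_finRange (e := e) (o := offset e)
    (F := fun i => (R i).code (Equiv.refl _)) fun i => by
      rw [offset_succ, nextBlock, length_code, (occursAt_code_iff.1 (h i)).1]
  refine ⟨occursAt_code_input_iff.2 ⟨rfl, h₁.2 h⟩, ?_⟩
  rw [← h₂, MonIsectInput.code, List.length_cons, add_comm]
  rfl

theorem entry_lt {B : ℕ} (hB : 0 < B) (L j : ℕ) : entry B L j < B := Nat.mod_lt _ hB

theorem acceptsCode_of_mem_monIsect {w : List Γ'} (hw : w ∈ MonIsect Mon) :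
    AcceptsCode (stringCode w) := by
  obtain ⟨I, -, ⟨x, hx⟩, rfl⟩ := hw
  set N := stringCode I.encode with hN
  have hlen : I.code.length ≤ (num N).length :=
    (length_le_length_trList _).trans (length_le_length_num_stringCode _)
  -- The numbers in the input are digits in base `N + 1`.
  have hlt : ∀ y ∈ I.code, y < N + 1 := fun y hy =>
    (lt_two_pow_length_trNat y).trans_le <|
      (Nat.pow_le_pow_right two_pos (length_trNat_le hy)).trans (pow_le_stringCode _)
  obtain ⟨L, hL, hent⟩ := exists_entry_eq (B := N + 1) (k := I.code.length)
    (f := fun j => I.code.getD j 0) fun j hj => by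
      rw [List.getD_eq_getElem _ _ hj]; exact hlt _ (List.getElem_mem _)
  set e := entry (N + 1) L with he
  have hocc : OccursAt e 0 I.code := fun j hj => by
    rw [zero_add, hent j hj, List.getD_eq_getElem _ _ hj]
  have h0 := (occursAt_code_input_iff.1 hocc).1
  obtain ⟨hblock, hoff⟩ := occursAt_code_of_input hocc
  have hk : I.k < I.code.length := by have := succ_le_offset e I.k; omega
  have hcap : ∀ i ≤ I.k, cappedOffset (N + 1) L (I.code.length + 1) i = offset e i := fun i hi =>
    min_eq_left ((((offset_strictMono e).monotone hi).trans hoff.le).trans (Nat.le_succ _))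
  have hvalid : ∀ i < I.k, ValidBlock e (cappedOffset (N + 1) L (I.code.length + 1) i) :=
    fun i hi => by
      rw [hcap i hi.le]; exact validBlock_of_occursAt (hblock ⟨i, hi⟩) h0
  have hpow : ∀ m ≤ I.code.length, (N + 1) ^ m ≤ (N + 1) ^ (num N).length := fun m hm =>
    Nat.pow_le_pow_right N.succ_pos (hm.trans hlen)
  refine ⟨L, hL.trans_le (hpow _ le_rfl), I.code.length, by omega, I.k, hk, ⟨?_, ?_⟩, hvalid, ?_⟩
  · rw [← he, listCode_eq, occursAt_zero_iff.1 hocc]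
    exact min_eq_left N.le_succ
  · rw [hcap _ le_rfl, hoff]
  · refine (tupleAccepts_iff (hpow _ hk.le) (fun i _ => (entry_lt N.succ_pos _ _).le) hvalid).2
      ⟨(FreeMonoid.toList x).map fun c => (I.ltr.symm c : ℕ), fun c hc => ?_, fun i hi => ?_⟩
    · obtain ⟨c, -, rfl⟩ := List.mem_map.1 hc
      rw [← he, h0]
      exact Fin.is_lt _
    · rw [hcap i hi.le]
      exact (exists_isNeutral_iff (hblock ⟨i, hi⟩) h0 _).2 (Set.mem_iInter.1 hx ⟨i, hi⟩)

theorem mem_monIsect_of_acceptsCode {w : List Γ'} (h : AcceptsCode (stringCode w)) :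
    w ∈ MonIsect Mon := by
  set N := stringCode w with hN
  obtain ⟨L, -, n, hn, k, hk, ⟨hlist, hoff⟩, hvalid, hacc⟩ := h
  rw [tupleAccepts_iff (Nat.pow_le_pow_right N.succ_pos (by omega))
    (fun i _ => (entry_lt N.succ_pos _ _).le) hvalid] at hacc
  set e := entry (N + 1) L with he
  obtain ⟨u, hu, hacc⟩ := hacc
  -- The caps are not reached.
  have hw : trList ((List.range n).map e) = w := by
    refine stringCode_injective ?_
    rw [← listCode_eq, ← hN]
    omega
  have hoff' : offset e k = n := by rw [cappedOffset, ← he] at hoff; omega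
  have hcap : ∀ i < k, cappedOffset (N + 1) L (n + 1) i = offset e i := fun i hi =>
    min_eq_left (((offset_strictMono e hi).le.trans hoff'.le).trans (Nat.le_succ _))
  have hex : ∀ i : Fin k, ∃ R : Recognizer (Fin (e 0)),
      OccursAt e (offset e i) (R.code (Equiv.refl _)) := fun i =>
    (hcap i i.2 ▸ hvalid i i.2).exists_recognizer
  choose R hR using hex
  obtain ⟨hocc, hlen⟩ := occursAt_code_input_of_blocks hR
  refine ⟨⟨_, _, Equiv.refl _, k, R⟩, fun i => Finite.of_equiv _ (R i).enum,
    ⟨FreeMonoid.ofList (u.pmap Fin.mk hu), Set.mem_iInter.2 fun i => ?_⟩, ?_⟩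
  · refine (exists_isNeutral_iff (hR i) rfl _).1 ?_
    have := hacc i i.2
    rw [hcap i i.2] at this
    simpa [List.map_pmap] using this
  · rw [MonIsectInput.encode, ← occursAt_zero_iff.1 hocc, hlen, hoff', hw]

end SpaceBounded

theorem mainTheorem8 : MonIsect Mon ∈ PSPACE Turing.PartrecToTM2.Γ' :=
  SpaceBounded.mem_PSPACE_of_polySpacePred SpaceBounded.polySpacePred_acceptsCode fun _ =>
    ⟨SpaceBounded.acceptsCode_of_mem_monIsect, SpaceBounded.mem_monIsect_of_acceptsCode⟩
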